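/- Let $[n]=\{1,\dots,n\}$, and order $[n]^k$ coordinatewise ($a\preceq b$ iff $a_i\le b_i$ for all $i$). A deterministic query algorithm for $[n]^k$ has query access to an unknown function $f:[n]^k\to[n]^k$: in each round it either sends a query $x\in[n]^k$, chosen as a function of the answers received so far, and learns $f(x)$, or it stops and outputs a point of $[n]^k$. Then for every fixed $k$ there is a deterministic query algorithm that, given $n\ge 1$, finds a fixed point of every monotone $f:[n]^k\to[n]^k$ using $O(\log^{\lceil (k+1)/2\rceil} n)$ queries. That is, there is a constant $C_k$, depending only on $k$, such that for every $n\ge 1$ and every monotone $f:[n]^k\to[n]^k$ the algorithm outputs a point $x$ with $f(x)=x$ after at most $C_k\,(\log n)^{\lceil (k+1)/2\rceil}$ queries. -/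

import Mathlib

/-- The grid `[n]^k` with its coordinatewise order. The chain `[n] = {1, …, n}` is
represented by `Fin n = {0, …, n - 1}`, that is, with all coordinates shifted by one. -/
abbrev Grid (n k : ℕ) : Type := Fin k → Fin n

/-- A deterministic query algorithm on the grid `[n]^k`, as a decision tree: it either stops
and outputs a grid point, or it queries a grid point `x` and continues in a way that depends
on the value `f x` that the query reveals. -/
inductive QueryAlgorithm (n k : ℕ) : Type
  | output (x : Grid n k) : QueryAlgorithm n k
  | query (x : Grid n k) (next : Grid n k → QueryAlgorithm n k) : QueryAlgorithm n k

/-- The point that the algorithm outputs when its queries are answered by `f`. -/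
def QueryAlgorithm.result {n k : ℕ} (f : Grid n k → Grid n k) :
    QueryAlgorithm n k → Grid n k
  | .output x => x
  | .query x next => (next (f x)).result f

/-- The number of queries that the algorithm makes when its queries are answered by `f`. -/
def QueryAlgorithm.numQueries {n k : ℕ} (f : Grid n k → Grid n k) :
    QueryAlgorithm n k → ℕ
  | .output _ => 0
  | .query x next => (next (f x)).numQueries f + 1

/-- The algorithm finds a fixed point of every monotone `f : [n]^k → [n]^k` and makes at most
`q` queries on each of them. -/
def QueryAlgorithm.SolvesTarski {n k : ℕ} (A : QueryAlgorithm n k) (q : ℝ) : Prop :=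
  ∀ f : Grid n k → Grid n k, Monotone f →
    Function.IsFixedPt f (A.result f) ∧ (A.numQueries f : ℝ) ≤ q

/-! The core is a relaxed problem: for a monotone `f` and an upper set `S`, find `z` with `z ≤ f z`
and `z ∈ S`, or with `f z ≤ z` and `z ∉ S`. Solve it on a hyperplane `z i = c` for the other
coordinates of `f`, with `S` the set where `c ≤ f z i`. A solution of the first kind is a post-fixed
point of the full map; one of the second kind becomes a pre-fixed point when coordinate `i` is
lowered to `c - 1`. Either way one side of the box is halved (`querySolvable_fixedPoint`), so
dimension `2m + 1` costs `O(log n)` relaxed searches in dimension `2m`.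

In the plane the relaxed problem takes only `O(log n)` queries (`starSolvable_plane`). The invariant
is not that the corners are post- and pre-fixed, but a weaker pair of certificates on the sides of
the box. These survive a cut through any pivot (`plane_pivot`) and still force a solution in a box
of side lengths at most one.

Higher even dimensions follow from `StarSolvable.prod`. A planar search is simulated on the first
two coordinates, and each of its queries is answered by five relaxed searches in the fibre, which
determine `S` and the sign of the displacement in each planar coordinate. The fibre searches leave
lower and upper points. Each new search is confined between the ones already found, so these stay
ordered, all recorded answers are monotone, and they extend to one genuine planar oracle. Thus
dimension `2m` costs `O(log^m n)`; with `m = ⌊k/2⌋` and padding for even `k`, the exponent is `m +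
1`. -/

open Set

/-! ### Adaptive queries under a promise on the oracle -/

/-- `QuerySolvable X good P q`: with at most `q` adaptive queries at points of `X` to an unknown
oracle `φ ∈ P`, a deterministic algorithm can produce an output `o` with `good o φ`. -/
inductive QuerySolvable {Q R O : Type*} (X : Set Q) (good : O → (Q → R) → Prop) :
    Set (Q → R) → ℕ → Prop
  | output {P : Set (Q → R)} {q : ℕ} (o : O) (h : ∀ φ ∈ P, good o φ) : QuerySolvable X good P q
  | query {P : Set (Q → R)} {q : ℕ} (x : Q) (hx : x ∈ X)
      (h : ∀ r, QuerySolvable X good {φ | φ ∈ P ∧ φ x = r} q) : QuerySolvable X good P (q + 1)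

namespace QuerySolvable

variable {Q R O Q' R' O' : Type*} {X : Set Q} {good : O → (Q → R) → Prop}
  {P P' : Set (Q → R)} {q q' : ℕ}

theorem mono (h : QuerySolvable X good P q) (hP : P' ⊆ P) (hq : q ≤ q') :
    QuerySolvable X good P' q' := by
  induction h generalizing P' q' with
  | output o h => exact .output o fun φ hφ => h φ (hP hφ)
  | query x hx h ih =>
    obtain ⟨q', rfl⟩ : ∃ q'', q' = q'' + 1 := ⟨q' - 1, by omega⟩
    exact .query x hx fun r => ih r (fun φ hφ => ⟨hP hφ.1, hφ.2⟩) (by omega)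

theorem of_isEmpty [Nonempty O] (h : ∀ φ, φ ∉ P) : QuerySolvable X good P q :=
  .output (Classical.arbitrary O) fun φ hφ => absurd hφ (h φ)

/-- Query a point; it suffices to continue for the answers of oracles in the class. -/
theorem query_of_mem [Nonempty O] (x : Q) (hx : x ∈ X)
    (h : ∀ φ₀ ∈ P, QuerySolvable X good {φ | φ ∈ P ∧ φ x = φ₀ x} q) :
    QuerySolvable X good P (q + 1) := by
  refine .query x hx fun r => ?_
  by_cases hr : ∃ φ₀ ∈ P, φ₀ x = r
  · obtain ⟨φ₀, h₀, rfl⟩ := hr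
    exact h φ₀ h₀
  · exact of_isEmpty fun φ hφ => hr ⟨φ, hφ.1, hφ.2⟩

/-- Query all points of a list. -/
theorem query_list [Nonempty O] (xs : List Q) (hx : ∀ x ∈ xs, x ∈ X)
    (h : ∀ φ₀ ∈ P, QuerySolvable X good {φ | φ ∈ P ∧ ∀ x ∈ xs, φ x = φ₀ x} q) :
    QuerySolvable X good P (q + xs.length) := by
  induction xs generalizing P with
  | nil =>
    by_cases hP : ∃ φ₀, φ₀ ∈ P
    · obtain ⟨φ₀, h₀⟩ := hP
      exact (h φ₀ h₀).mono (fun φ hφ => ⟨hφ, by simp⟩) (by simp)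
    · exact of_isEmpty fun φ hφ => hP ⟨φ, hφ⟩
  | cons a xs ih =>
    refine query_of_mem (q := q + xs.length) a (hx a (by simp)) fun φ₀ h₀ => ?_
    refine ih (fun x hx' => hx x (by simp [hx'])) fun φ₁ h₁ => ?_
    refine (h φ₁ h₁.1).mono ?_ le_rfl
    rintro φ ⟨⟨h2, h3⟩, h4⟩
    refine ⟨h2, fun x hx' => ?_⟩
    rcases List.mem_cons.1 hx' with rfl | hx'
    · rw [h3, h₁.2]
    · exact h4 x hx'

/-- Sequential composition: use the output of a first algorithm to continue. -/
theorem bind {good' : O' → (Q → R) → Prop} (h : QuerySolvable X good P q)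
    (h' : ∀ o, QuerySolvable X good' {φ | φ ∈ P ∧ good o φ} q') :
    QuerySolvable X good' P (q + q') := by
  induction h with
  | output o h => exact (h' o).mono (fun φ hφ => ⟨hφ, h φ hφ⟩) (by omega)
  | @query P q x hx h ih =>
    have : QuerySolvable X good' P ((q + q') + 1) := .query x hx fun r => ih r fun o =>
      (h' o).mono (fun φ hφ => ⟨hφ.1.1, hφ.2⟩) le_rfl
    exact this.mono subset_rfl (by omega)

/-- Simulation: each query to `T φ` is answered by one query to `φ`. -/
theorem comap {X' : Set Q'} (h : QuerySolvable X good P q) (T : (Q' → R') → Q → R) (e : Q → Q')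
    (τ : Q → R' → R) (hT : ∀ φ x, T φ x = τ x (φ (e x))) (he : ∀ x ∈ X, e x ∈ X')
    {P' : Set (Q' → R')} (hP : ∀ φ ∈ P', T φ ∈ P) :
    QuerySolvable X' (fun o φ => good o (T φ)) P' q := by
  induction h generalizing P' with
  | output o h => exact .output o fun φ hφ => h _ (hP φ hφ)
  | query x hx h ih =>
    refine .query (e x) (he x hx) fun r => ih (τ x r) ?_
    rintro φ ⟨h1, h2⟩
    exact ⟨hP φ h1, by rw [hT, h2]⟩

/-- Push the output through a function. -/
theorem map {good' : O' → (Q → R) → Prop} (h : QuerySolvable X good P q) (g : O → O')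
    (h' : ∀ o, ∀ φ ∈ P, good o φ → good' (g o) φ) : QuerySolvable X good' P q :=
  h.bind (q' := 0) fun o => .output (g o) fun φ hφ => h' o φ hφ.1 hφ.2

/-- A solvable problem on the grid is solved by a decision tree. -/
theorem exists_queryAlgorithm {n k : ℕ} {X : Set (Grid n k)}
    {good : Grid n k → (Grid n k → Grid n k) → Prop} {P : Set (Grid n k → Grid n k)} {q : ℕ}
    (h : QuerySolvable X good P q) :
    ∃ A : QueryAlgorithm n k, ∀ f ∈ P, good (A.result f) f ∧ A.numQueries f ≤ q := by
  induction h with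
  | output o h => exact ⟨.output o, fun f hf => ⟨h f hf, Nat.zero_le _⟩⟩
  | query x hx h ih =>
    choose A hA using ih
    refine ⟨.query x A, fun f hf => ?_⟩
    obtain ⟨h1, h2⟩ := hA (f x) f ⟨hf, rfl⟩
    exact ⟨h1, Nat.succ_le_succ h2⟩

end QuerySolvable

/-! ### The relaxed Tarski problem -/

/-- Oracles `φ = (f, S)` with `f` monotone, `l ≤ f l`, `f u ≤ u`, and `S` an upper set. -/
def starClass {Z : Type*} [Preorder Z] (l u : Z) : Set (Z → Z × Prop) :=
  {φ | Monotone φ ∧ l ≤ (φ l).1 ∧ (φ u).1 ≤ u}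

/-- `z` is a post-fixed point of `f` in `S` or a pre-fixed point of `f` outside `S`. -/
def IsStarPoint {Z : Type*} [Preorder Z] (φ : Z → Z × Prop) (z : Z) : Prop :=
  (z ≤ (φ z).1 ∧ (φ z).2) ∨ ((φ z).1 ≤ z ∧ ¬ (φ z).2)

/-- The relaxed Tarski problem on the box `[l, u]` can be solved with `q` queries. -/
def StarSolvable {Z : Type*} [Preorder Z] (l u : Z) (q : ℕ) : Prop :=
  QuerySolvable (Icc l u) (fun z φ => z ∈ Icc l u ∧ IsStarPoint φ z) (starClass l u) q

/-- Solvability passes to order retracts. -/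
theorem StarSolvable.retract {Z Z' : Type*} [Preorder Z] [Preorder Z'] {e : Z → Z'} {p : Z' → Z}
    (he : Monotone e) (hp : Monotone p) (hpe : ∀ z, p (e z) = z) {l u : Z} {q : ℕ}
    (h : StarSolvable (e l) (e u) q) : StarSolvable l u q := by
  have hbox : ∀ z ∈ Icc (e l) (e u), p z ∈ Icc l u := fun z hz =>
    ⟨by simpa [hpe] using hp hz.1, by simpa [hpe] using hp hz.2⟩
  have := QuerySolvable.comap (X' := Icc l u) (P' := starClass l u) h
    (fun φ z => (e (φ (p z)).1, (φ (p z)).2)) p (fun _ r => (e r.1, r.2)) (fun _ _ => rfl) hbox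
    (by
      rintro φ ⟨h1, h2, h3⟩
      refine ⟨fun a b hab => ⟨he (h1 (hp hab)).1, (h1 (hp hab)).2⟩, ?_, ?_⟩
      · simpa [hpe] using he h2
      · simpa [hpe] using he h3)
  refine this.map p ?_
  rintro z φ - ⟨hz, h | h⟩
  · exact ⟨hbox z hz, Or.inl ⟨by simpa [hpe] using hp h.1, h.2⟩⟩
  · exact ⟨hbox z hz, Or.inr ⟨by simpa [hpe] using hp h.1, h.2⟩⟩

/-! ### Certificates on the sides of planar boxes -/

/-- The lower part of `PlaneBox`: a certificate on the left or on the bottom side of the box. -/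
def PlaneLow (φ : ℤ × ℤ → (ℤ × ℤ) × Prop) (a b : ℤ × ℤ) : Prop :=
  (a.2 ≤ (φ (a.1, a.2)).1.2 ∧
    ∃ y, a.2 ≤ y ∧ y ≤ b.2 ∧ ¬ (φ (a.1, y)).2 ∧ a.1 ≤ (φ (a.1, y)).1.1) ∨
  (a.1 ≤ (φ (a.1, a.2)).1.1 ∧
    ∃ x, a.1 ≤ x ∧ x ≤ b.1 ∧ ¬ (φ (x, a.2)).2 ∧ a.2 ≤ (φ (x, a.2)).1.2)

/-- The upper part of `PlaneBox`: a certificate on the right or on the top side of the box. -/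
def PlaneHigh (φ : ℤ × ℤ → (ℤ × ℤ) × Prop) (a b : ℤ × ℤ) : Prop :=
  ((φ (b.1, b.2)).1.2 ≤ b.2 ∧
    ∃ y, a.2 ≤ y ∧ y ≤ b.2 ∧ (φ (b.1, y)).2 ∧ (φ (b.1, y)).1.1 ≤ b.1) ∨
  ((φ (b.1, b.2)).1.1 ≤ b.1 ∧
    ∃ x, a.1 ≤ x ∧ x ≤ b.1 ∧ (φ (x, b.2)).2 ∧ (φ (x, b.2)).1.2 ≤ b.2)

/-- The promise on a planar box that the search maintains; it forces a star point in the box. -/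
def PlaneBox (φ : ℤ × ℤ → (ℤ × ℤ) × Prop) (a b : ℤ × ℤ) : Prop :=
  PlaneLow φ a b ∧ PlaneHigh φ a b

section Plane

variable {φ : ℤ × ℤ → (ℤ × ℤ) × Prop} {a₁ a₂ b₁ b₂ m₁ m₂ : ℤ}

theorem Monotone.plane (hφ : Monotone φ) {x x' y y' : ℤ} (hx : x ≤ x') (hy : y ≤ y') :
    (φ (x, y)).1.1 ≤ (φ (x', y')).1.1 ∧ (φ (x, y)).1.2 ≤ (φ (x', y')).1.2 ∧
      ((φ (x, y)).2 → (φ (x', y')).2) := by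
  have h : φ (x, y) ≤ φ (x', y') := hφ (Prod.mk_le_mk.2 ⟨hx, hy⟩)
  exact ⟨h.1.1, h.1.2, h.2⟩

theorem not_isStarPoint_plane {x y : ℤ} (h : ¬ IsStarPoint φ (x, y)) :
    ((φ (x, y)).2 → (φ (x, y)).1.1 < x ∨ (φ (x, y)).1.2 < y) ∧
      (¬ (φ (x, y)).2 → x < (φ (x, y)).1.1 ∨ y < (φ (x, y)).1.2) := by
  simp only [IsStarPoint, Prod.le_def] at h
  push Not at h
  constructor
  · intro hs
    by_contra! hc
    exact h.1 ⟨hc.1, hc.2⟩ hs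
  · intro hs
    by_contra! hc
    exact hs (h.2 ⟨hc.1, hc.2⟩)

/-- Only a bottom-side witness `x > m₁` can be lost. In that case `(m₁, a₂)` is outside `S` and its
first coordinate moves down, so, not being a star point, it moves up in the second coordinate and
replaces `x`. -/
theorem PlaneLow.anti_of_fst (hφ : Monotone φ) (h : PlaneLow φ (a₁, a₂) (b₁, b₂)) (h₁ : a₁ ≤ m₁)
    (hm : a₂ ≤ m₂) (hs : (φ (m₁, m₂)).1.1 < m₁) (hc : ¬ IsStarPoint φ (m₁, a₂)) :
    PlaneLow φ (a₁, a₂) (m₁, b₂) := by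
  rcases h with h | ⟨h, x, h2, h3, h4, h5⟩
  · exact Or.inl h
  · refine Or.inr ⟨h, ?_⟩
    by_cases hx : x ≤ m₁
    · exact ⟨x, h2, hx, h4, h5⟩
    · have e1 := hφ.plane (x := m₁) (x' := x) (y := a₂) (y' := a₂) (by omega) le_rfl
      have e2 := hφ.plane (x := m₁) (x' := m₁) (y := a₂) (y' := m₂) le_rfl hm
      have e3 := not_isStarPoint_plane hc
      have e4 : ¬ (φ (m₁, a₂)).2 := fun h => h4 (e1.2.2 h)
      have := e3.2 e4
      exact ⟨m₁, h₁, le_rfl, e4, by dsimp only at *; omega⟩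

theorem PlaneLow.anti_of_snd (hφ : Monotone φ) (h : PlaneLow φ (a₁, a₂) (b₁, b₂)) (h₂ : a₂ ≤ m₂)
    (hm : a₁ ≤ m₁) (hs : (φ (m₁, m₂)).1.2 < m₂) (hc : ¬ IsStarPoint φ (a₁, m₂)) :
    PlaneLow φ (a₁, a₂) (b₁, m₂) := by
  rcases h with ⟨h, y, h2, h3, h4, h5⟩ | h
  · refine Or.inl ⟨h, ?_⟩
    by_cases hx : y ≤ m₂
    · exact ⟨y, h2, hx, h4, h5⟩
    · have e1 := hφ.plane (x := a₁) (x' := a₁) (y := m₂) (y' := y) le_rfl (by omega)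
      have e2 := hφ.plane (x := a₁) (x' := m₁) (y := m₂) (y' := m₂) hm le_rfl
      have e3 := not_isStarPoint_plane hc
      have e4 : ¬ (φ (a₁, m₂)).2 := fun h => h4 (e1.2.2 h)
      have := e3.2 e4
      exact ⟨m₂, h₂, le_rfl, e4, by dsimp only at *; omega⟩
  · exact Or.inr h

theorem PlaneHigh.anti_of_fst (hφ : Monotone φ) (h : PlaneHigh φ (a₁, a₂) (b₁, b₂)) (h₁ : m₁ ≤ b₁)
    (hm : m₂ ≤ b₂) (hs : m₁ < (φ (m₁, m₂)).1.1) (hc : ¬ IsStarPoint φ (m₁, b₂)) :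
    PlaneHigh φ (m₁, a₂) (b₁, b₂) := by
  rcases h with h | ⟨h, x, h2, h3, h4, h5⟩
  · exact Or.inl h
  · refine Or.inr ⟨h, ?_⟩
    by_cases hx : m₁ ≤ x
    · exact ⟨x, hx, h3, h4, h5⟩
    · have e1 := hφ.plane (x := x) (x' := m₁) (y := b₂) (y' := b₂) (by omega) le_rfl
      have e2 := hφ.plane (x := m₁) (x' := m₁) (y := m₂) (y' := b₂) le_rfl hm
      have e3 := not_isStarPoint_plane hc
      have e4 : (φ (m₁, b₂)).2 := e1.2.2 h4
      have := e3.1 e4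
      exact ⟨m₁, le_rfl, h₁, e4, by dsimp only at *; omega⟩

theorem PlaneHigh.anti_of_snd (hφ : Monotone φ) (h : PlaneHigh φ (a₁, a₂) (b₁, b₂)) (h₂ : m₂ ≤ b₂)
    (hm : m₁ ≤ b₁) (hs : m₂ < (φ (m₁, m₂)).1.2) (hc : ¬ IsStarPoint φ (b₁, m₂)) :
    PlaneHigh φ (a₁, m₂) (b₁, b₂) := by
  rcases h with ⟨h, y, h2, h3, h4, h5⟩ | h
  · refine Or.inl ⟨h, ?_⟩
    by_cases hx : m₂ ≤ y
    · exact ⟨y, hx, h3, h4, h5⟩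
    · have e1 := hφ.plane (x := b₁) (x' := b₁) (y := y) (y' := m₂) le_rfl (by omega)
      have e2 := hφ.plane (x := m₁) (x' := b₁) (y := m₂) (y' := m₂) hm le_rfl
      have e3 := not_isStarPoint_plane hc
      have e4 : (φ (b₁, m₂)).2 := e1.2.2 h4
      have := e3.1 e4
      exact ⟨m₂, le_rfl, h₂, e4, by dsimp only at *; omega⟩
  · exact Or.inr h

/-- If the new corner `(m₁, b₂)` does not move up, the pivot is a witness on the new right side. If
it does, monotonicity rules out an old right-side certificate and forces the witness of an old
top-side one to lie left of `m₁`, so that witness can be kept. -/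
theorem PlaneHigh.shrink_fst (hφ : Monotone φ) (h : PlaneHigh φ (a₁, a₂) (b₁, b₂))
    (h₁ : m₁ ≤ b₁) (h₂ : a₂ ≤ m₂) (h₃ : m₂ ≤ b₂) (hS : (φ (m₁, m₂)).2)
    (hs : (φ (m₁, m₂)).1.1 < m₁) (hc : ¬ IsStarPoint φ (m₁, b₂)) :
    PlaneHigh φ (a₁, a₂) (m₁, b₂) := by
  have e1 := (hφ.plane (x := m₁) (x' := m₁) le_rfl h₃).2.2 hS
  have e2 := (not_isStarPoint_plane hc).1 e1
  by_cases e3 : (φ (m₁, b₂)).1.2 ≤ b₂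
  · exact Or.inl ⟨e3, m₂, h₂, h₃, hS, hs.le⟩
  · rcases h with ⟨h, -⟩ | ⟨h, x, h2, h3, h4, h5⟩
    · exact absurd ((hφ.plane h₁ le_rfl).2.1.trans h) e3
    · refine Or.inr ⟨?_, x, h2, ?_, h4, h5⟩
      · dsimp only at *; omega
      · by_contra hx
        exact e3 ((hφ.plane (not_le.1 hx).le le_rfl).2.1.trans h5)

theorem PlaneHigh.shrink_snd (hφ : Monotone φ) (h : PlaneHigh φ (a₁, a₂) (b₁, b₂))
    (h₁ : m₂ ≤ b₂) (h₂ : a₁ ≤ m₁) (h₃ : m₁ ≤ b₁) (hS : (φ (m₁, m₂)).2)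
    (hs : (φ (m₁, m₂)).1.2 < m₂) (hc : ¬ IsStarPoint φ (b₁, m₂)) :
    PlaneHigh φ (a₁, a₂) (b₁, m₂) := by
  have e1 := (hφ.plane (y := m₂) (y' := m₂) h₃ le_rfl).2.2 hS
  have e2 := (not_isStarPoint_plane hc).1 e1
  by_cases e3 : (φ (b₁, m₂)).1.1 ≤ b₁
  · exact Or.inr ⟨e3, m₁, h₂, h₃, hS, hs.le⟩
  · rcases h with ⟨h, y, h2, h3, h4, h5⟩ | ⟨h, -⟩
    · refine Or.inl ⟨?_, y, h2, ?_, h4, h5⟩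
      · dsimp only at *; omega
      · by_contra hx
        exact e3 ((hφ.plane le_rfl (not_le.1 hx).le).1.trans h5)
    · exact absurd ((hφ.plane le_rfl h₁).1.trans h) e3

theorem PlaneLow.shrink_fst (hφ : Monotone φ) (h : PlaneLow φ (a₁, a₂) (b₁, b₂))
    (h₁ : a₁ ≤ m₁) (h₂ : a₂ ≤ m₂) (h₃ : m₂ ≤ b₂) (hS : ¬ (φ (m₁, m₂)).2)
    (hs : m₁ < (φ (m₁, m₂)).1.1) (hc : ¬ IsStarPoint φ (m₁, a₂)) :
    PlaneLow φ (m₁, a₂) (b₁, b₂) := by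
  have e1 : ¬ (φ (m₁, a₂)).2 := fun h => hS ((hφ.plane (x := m₁) (x' := m₁) le_rfl h₂).2.2 h)
  have e2 := (not_isStarPoint_plane hc).2 e1
  by_cases e3 : a₂ ≤ (φ (m₁, a₂)).1.2
  · exact Or.inl ⟨e3, m₂, h₂, h₃, hS, hs.le⟩
  · rcases h with ⟨h, -⟩ | ⟨h, x, h2, h3, h4, h5⟩
    · exact absurd (h.trans (hφ.plane h₁ le_rfl).2.1) e3
    · refine Or.inr ⟨?_, x, ?_, h3, h4, h5⟩
      · dsimp only at *; omega
      · by_contra hx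
        exact e3 (h5.trans (hφ.plane (not_le.1 hx).le le_rfl).2.1)

theorem PlaneLow.shrink_snd (hφ : Monotone φ) (h : PlaneLow φ (a₁, a₂) (b₁, b₂))
    (h₁ : a₂ ≤ m₂) (h₂ : a₁ ≤ m₁) (h₃ : m₁ ≤ b₁) (hS : ¬ (φ (m₁, m₂)).2)
    (hs : m₂ < (φ (m₁, m₂)).1.2) (hc : ¬ IsStarPoint φ (a₁, m₂)) :
    PlaneLow φ (a₁, m₂) (b₁, b₂) := by
  have e1 : ¬ (φ (a₁, m₂)).2 := fun h => hS ((hφ.plane (y := m₂) (y' := m₂) h₂ le_rfl).2.2 h)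
  have e2 := (not_isStarPoint_plane hc).2 e1
  by_cases e3 : a₁ ≤ (φ (a₁, m₂)).1.1
  · exact Or.inr ⟨e3, m₁, h₂, h₃, hS, hs.le⟩
  · rcases h with ⟨h, y, h2, h3, h4, h5⟩ | ⟨h, -⟩
    · refine Or.inl ⟨?_, y, ?_, h3, h4, h5⟩
      · dsimp only at *; omega
      · by_contra hx
        exact e3 (h5.trans (hφ.plane le_rfl (not_le.1 hx).le).1)
    · exact absurd (h.trans (hφ.plane le_rfl h₁).1) e3

/-- The corners of a `PlaneBox` of side lengths at most one contain a star point. -/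
theorem PlaneBox.exists_isStarPoint (hφ : Monotone φ) (h : PlaneBox φ (a₁, a₂) (b₁, b₂))
    (h₁ : a₁ ≤ b₁) (h₂ : a₂ ≤ b₂) (h₃ : b₁ ≤ a₁ + 1) (h₄ : b₂ ≤ a₂ + 1) :
    IsStarPoint φ (a₁, a₂) ∨ IsStarPoint φ (a₁, b₂) ∨ IsStarPoint φ (b₁, a₂) ∨
      IsStarPoint φ (b₁, b₂) := by
  by_contra! hc
  obtain ⟨hc1, hc2, hc3, hc4⟩ := hc
  have k1 := not_isStarPoint_plane hc1
  have k2 := not_isStarPoint_plane hc2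
  have k3 := not_isStarPoint_plane hc3
  have k4 := not_isStarPoint_plane hc4
  have m1 := hφ.plane (le_refl a₁) h₂
  have m2 := hφ.plane h₁ (le_refl a₂)
  have m3 := hφ.plane h₁ (le_refl b₂)
  have m4 := hφ.plane (le_refl b₁) h₂
  have hx : ∀ x, a₁ ≤ x → x ≤ b₁ → x = a₁ ∨ x = b₁ := by intros; omega
  have hy : ∀ x, a₂ ≤ x → x ≤ b₂ → x = a₂ ∨ x = b₂ := by intros; omega
  obtain ⟨hL, hH⟩ := h
  -- With side lengths at most one every witness is a corner, and the lower left corner is outside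
  -- `S` because some witness above it is.
  have hL' : (¬ (φ (a₁, a₂)).2) ∧ ((a₂ ≤ (φ (a₁, a₂)).1.2 ∧ (a₁ ≤ (φ (a₁, a₂)).1.1 ∨
      (¬ (φ (a₁, b₂)).2 ∧ a₁ ≤ (φ (a₁, b₂)).1.1))) ∨ (a₁ ≤ (φ (a₁, a₂)).1.1 ∧
      (a₂ ≤ (φ (a₁, a₂)).1.2 ∨ (¬ (φ (b₁, a₂)).2 ∧ a₂ ≤ (φ (b₁, a₂)).1.2)))) := by
    rcases hL with ⟨h, y, q1, q2, q3, q4⟩ | ⟨h, y, q1, q2, q3, q4⟩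
    · rcases hy y q1 q2 with e | e <;> rw [e] at q3 q4
      · exact ⟨q3, Or.inl ⟨h, Or.inl q4⟩⟩
      · exact ⟨fun h => q3 (m1.2.2 h), Or.inl ⟨h, Or.inr ⟨q3, q4⟩⟩⟩
    · rcases hx y q1 q2 with e | e <;> rw [e] at q3 q4
      · exact ⟨q3, Or.inr ⟨h, Or.inl q4⟩⟩
      · exact ⟨fun h => q3 (m2.2.2 h), Or.inr ⟨h, Or.inr ⟨q3, q4⟩⟩⟩
  have hH' : ((φ (b₁, b₂)).2) ∧ (((φ (b₁, b₂)).1.2 ≤ b₂ ∧ ((φ (b₁, b₂)).1.1 ≤ b₁ ∨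
      ((φ (b₁, a₂)).2 ∧ (φ (b₁, a₂)).1.1 ≤ b₁))) ∨ ((φ (b₁, b₂)).1.1 ≤ b₁ ∧
      ((φ (b₁, b₂)).1.2 ≤ b₂ ∨ ((φ (a₁, b₂)).2 ∧ (φ (a₁, b₂)).1.2 ≤ b₂)))) := by
    rcases hH with ⟨h, y, q1, q2, q3, q4⟩ | ⟨h, y, q1, q2, q3, q4⟩
    · rcases hy y q1 q2 with e | e <;> rw [e] at q3 q4
      · exact ⟨m4.2.2 q3, Or.inl ⟨h, Or.inr ⟨q3, q4⟩⟩⟩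
      · exact ⟨q3, Or.inl ⟨h, Or.inl q4⟩⟩
    · rcases hx y q1 q2 with e | e <;> rw [e] at q3 q4
      · exact ⟨m3.2.2 q3, Or.inr ⟨h, Or.inr ⟨q3, q4⟩⟩⟩
      · exact ⟨q3, Or.inr ⟨h, Or.inl q4⟩⟩
  clear hL hH hx hy hc1 hc2 hc3 hc4
  generalize (φ (a₁, a₂)).2 = S1 at *
  generalize (φ (a₁, b₂)).2 = S2 at *
  generalize (φ (b₁, a₂)).2 = S3 at *
  generalize (φ (b₁, b₂)).2 = S4 at *
  generalize (φ (a₁, a₂)).1.1 = p1 at *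
  generalize (φ (a₁, b₂)).1.1 = p2 at *
  generalize (φ (b₁, a₂)).1.1 = p3 at *
  generalize (φ (b₁, b₂)).1.1 = p4 at *
  generalize (φ (a₁, a₂)).1.2 = r1 at *
  generalize (φ (a₁, b₂)).1.2 = r2 at *
  generalize (φ (b₁, a₂)).1.2 = r3 at *
  generalize (φ (b₁, b₂)).1.2 = r4 at *
  -- Membership in `S` is open only at the two mixed corners; once it is fixed, linear arithmetic
  -- remains.
  by_cases s2 : S2 <;> by_cases s3 : S3 <;> simp only [s2, s3, hL'.1, hH'.1] at * <;>
    simp only [true_implies, false_implies, not_true_eq_false, not_false_eq_true, true_and, false_and, and_true,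
      or_false, implies_true] at * <;> omega

end Plane

/-! ### Logarithmic search in the plane -/

theorem isStarPoint_congr {Z : Type*} [Preorder Z] {φ ψ : Z → Z × Prop} {z : Z} (h : φ z = ψ z) :
    IsStarPoint φ z ↔ IsStarPoint ψ z := by
  simp only [IsStarPoint, h]

/-- Query a list of points; one may assume that none of them is a star point. -/
theorem query_list_star {Z : Type*} [Preorder Z] {l u : Z} {P : Set (Z → Z × Prop)} {q : ℕ}
    (xs : List Z) (hx : ∀ x ∈ xs, x ∈ Icc l u) [Nonempty Z]
    (h : ∀ φ₀ ∈ P, (∀ x ∈ xs, ¬ IsStarPoint φ₀ x) →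
      QuerySolvable (Icc l u) (fun z φ => z ∈ Icc l u ∧ IsStarPoint φ z)
        {φ | φ ∈ P ∧ ∀ x ∈ xs, φ x = φ₀ x} q) :
    QuerySolvable (Icc l u) (fun z φ => z ∈ Icc l u ∧ IsStarPoint φ z) P (q + xs.length) := by
  refine QuerySolvable.query_list xs hx fun φ₀ h₀ => ?_
  by_cases hs : ∃ x ∈ xs, IsStarPoint φ₀ x
  · obtain ⟨x, h1, h2⟩ := hs
    exact .output x fun φ hφ => ⟨hx x h1, (isStarPoint_congr (hφ.2 x h1)).2 h2⟩
  · push Not at hs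
    exact h φ₀ h₀ hs

section Plane

variable {l u : ℤ × ℤ} {P : Set (ℤ × ℤ → (ℤ × ℤ) × Prop)} {a₁ a₂ b₁ b₂ m₁ m₂ : ℤ} {q : ℕ}

/-- One step of the search: query a pivot and its projections to the sides of the box. -/
theorem plane_pivot (hP : ∀ φ ∈ P, Monotone φ) (hB : ∀ φ ∈ P, PlaneBox φ (a₁, a₂) (b₁, b₂))
    (hl₁ : l.1 ≤ a₁) (hl₂ : l.2 ≤ a₂) (hu₁ : b₁ ≤ u.1) (hu₂ : b₂ ≤ u.2)
    (h₁ : a₁ ≤ m₁) (h₁' : m₁ ≤ b₁) (h₂ : a₂ ≤ m₂) (h₂' : m₂ ≤ b₂)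
    (k₁ : QuerySolvable (Icc l u) (fun z φ => z ∈ Icc l u ∧ IsStarPoint φ z)
      {φ | φ ∈ P ∧ PlaneBox φ (a₁, a₂) (m₁, b₂) ∧ (φ (m₁, m₂)).2 ∧ (φ (m₁, m₂)).1.1 < m₁} q)
    (k₂ : QuerySolvable (Icc l u) (fun z φ => z ∈ Icc l u ∧ IsStarPoint φ z)
      {φ | φ ∈ P ∧ PlaneBox φ (a₁, a₂) (b₁, m₂) ∧ (φ (m₁, m₂)).2 ∧ (φ (m₁, m₂)).1.2 < m₂} q)
    (k₃ : QuerySolvable (Icc l u) (fun z φ => z ∈ Icc l u ∧ IsStarPoint φ z)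
      {φ | φ ∈ P ∧ PlaneBox φ (a₁, a₂) (m₁, m₂)} q)
    (k₄ : QuerySolvable (Icc l u) (fun z φ => z ∈ Icc l u ∧ IsStarPoint φ z)
      {φ | φ ∈ P ∧ PlaneBox φ (m₁, a₂) (b₁, b₂) ∧ ¬ (φ (m₁, m₂)).2 ∧ m₁ < (φ (m₁, m₂)).1.1} q)
    (k₅ : QuerySolvable (Icc l u) (fun z φ => z ∈ Icc l u ∧ IsStarPoint φ z)
      {φ | φ ∈ P ∧ PlaneBox φ (a₁, m₂) (b₁, b₂) ∧ ¬ (φ (m₁, m₂)).2 ∧ m₂ < (φ (m₁, m₂)).1.2} q)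
    (k₆ : QuerySolvable (Icc l u) (fun z φ => z ∈ Icc l u ∧ IsStarPoint φ z)
      {φ | φ ∈ P ∧ PlaneBox φ (m₁, m₂) (b₁, b₂)} q) :
    QuerySolvable (Icc l u) (fun z φ => z ∈ Icc l u ∧ IsStarPoint φ z) P (q + 5) := by
  refine query_list_star [(m₁, m₂), (m₁, a₂), (m₁, b₂), (a₁, m₂), (b₁, m₂)] ?_ fun φ₀ h₀ hn => ?_
  · simp only [List.mem_cons, List.not_mem_nil, or_false, forall_eq_or_imp, forall_eq, mem_Icc,
      Prod.le_def]
    omega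
  have n₀ := not_isStarPoint_plane (hn (m₁, m₂) (by simp))
  have key : ∀ φ ∈ {φ | φ ∈ P ∧ ∀ x ∈ [(m₁, m₂), (m₁, a₂), (m₁, b₂), (a₁, m₂), (b₁, m₂)],
      φ x = φ₀ x}, φ ∈ P ∧ Monotone φ ∧ PlaneBox φ (a₁, a₂) (b₁, b₂) ∧ φ (m₁, m₂) = φ₀ (m₁, m₂) ∧
      ¬ IsStarPoint φ (m₁, a₂) ∧ ¬ IsStarPoint φ (m₁, b₂) ∧ ¬ IsStarPoint φ (a₁, m₂) ∧
      ¬ IsStarPoint φ (b₁, m₂) := by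
    rintro φ ⟨hφ, he⟩
    refine ⟨hφ, hP φ hφ, hB φ hφ, he _ (by simp), ?_, ?_, ?_, ?_⟩ <;>
    exact fun h => hn _ (by simp) ((isStarPoint_congr (he _ (by simp))).1 h)
  by_cases hS : (φ₀ (m₁, m₂)).2
  · have n₁ := n₀.1 hS
    by_cases c₂ : m₂ ≤ (φ₀ (m₁, m₂)).1.2
    · have c₁ : (φ₀ (m₁, m₂)).1.1 < m₁ := by omega
      refine k₁.mono (fun φ hφ => ?_) le_rfl
      obtain ⟨e0, e1, ⟨e2, e2'⟩, e3, e4, e5, e6, e7⟩ := key φ hφ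
      rw [← e3] at hS c₁
      exact ⟨e0, ⟨e2.anti_of_fst e1 h₁ h₂ c₁ e4, e2'.shrink_fst e1 h₁' h₂ h₂' hS c₁ e5⟩, hS, c₁⟩
    · push Not at c₂
      by_cases c₁ : m₁ ≤ (φ₀ (m₁, m₂)).1.1
      · refine k₂.mono (fun φ hφ => ?_) le_rfl
        obtain ⟨e0, e1, ⟨e2, e2'⟩, e3, e4, e5, e6, e7⟩ := key φ hφ
        rw [← e3] at hS c₂
        exact ⟨e0, ⟨e2.anti_of_snd e1 h₂ h₁ c₂ e6, e2'.shrink_snd e1 h₂' h₁ h₁' hS c₂ e7⟩, hS, c₂⟩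
      · push Not at c₁
        refine k₃.mono (fun φ hφ => ?_) le_rfl
        obtain ⟨e0, e1, ⟨e2, e2'⟩, e3, e4, e5, e6, e7⟩ := key φ hφ
        rw [← e3] at hS c₁ c₂
        exact ⟨e0, (e2.anti_of_fst e1 h₁ h₂ c₁ e4).anti_of_snd e1 h₂ h₁ c₂ e6,
          Or.inl ⟨c₂.le, m₂, h₂, le_rfl, hS, c₁.le⟩⟩
  · have n₁ := n₀.2 hS
    by_cases c₂ : (φ₀ (m₁, m₂)).1.2 ≤ m₂
    · have c₁ : m₁ < (φ₀ (m₁, m₂)).1.1 := by omega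
      refine k₄.mono (fun φ hφ => ?_) le_rfl
      obtain ⟨e0, e1, ⟨e2, e2'⟩, e3, e4, e5, e6, e7⟩ := key φ hφ
      rw [← e3] at hS c₁
      exact ⟨e0, ⟨e2.shrink_fst e1 h₁ h₂ h₂' hS c₁ e4, e2'.anti_of_fst e1 h₁' h₂' c₁ e5⟩, hS, c₁⟩
    · push Not at c₂
      by_cases c₁ : (φ₀ (m₁, m₂)).1.1 ≤ m₁
      · refine k₅.mono (fun φ hφ => ?_) le_rfl
        obtain ⟨e0, e1, ⟨e2, e2'⟩, e3, e4, e5, e6, e7⟩ := key φ hφ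
        rw [← e3] at hS c₂
        exact ⟨e0, ⟨e2.shrink_snd e1 h₂ h₁ h₁' hS c₂ e6, e2'.anti_of_snd e1 h₂' h₁' c₂ e7⟩, hS, c₂⟩
      · push Not at c₁
        refine k₆.mono (fun φ hφ => ?_) le_rfl
        obtain ⟨e0, e1, ⟨e2, e2'⟩, e3, e4, e5, e6, e7⟩ := key φ hφ
        rw [← e3] at hS c₁ c₂
        exact ⟨e0, Or.inl ⟨c₂.le, m₂, le_rfl, h₂', hS, c₁.le⟩,
          (e2'.anti_of_fst e1 h₁' h₂' c₁ e5).anti_of_snd e1 h₂' h₁' c₂ e7⟩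

/-- On a box of width zero a left-side witness outside `S` lies below every point of `S` on that
side, so its inequality carries over. This excludes a pivot that would push the search out of the
segment. -/
theorem PlaneLow.le_fst {φ : ℤ × ℤ → (ℤ × ℤ) × Prop} (hφ : Monotone φ)
    (h : PlaneLow φ (a₁, a₂) (a₁, b₂)) (h₂ : a₂ ≤ m₂) (hS : (φ (a₁, m₂)).2) :
    a₁ ≤ (φ (a₁, m₂)).1.1 := by
  rcases h with ⟨-, y, -, -, h3, h4⟩ | ⟨h, -⟩
  · have hy : y ≤ m₂ := by
      by_contra hy
      exact h3 ((hφ.plane le_rfl (not_le.1 hy).le).2.2 hS)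
    exact h4.trans (hφ.plane le_rfl hy).1
  · exact h.trans (hφ.plane le_rfl h₂).1

theorem PlaneLow.le_snd {φ : ℤ × ℤ → (ℤ × ℤ) × Prop} (hφ : Monotone φ)
    (h : PlaneLow φ (a₁, a₂) (b₁, a₂)) (h₁ : a₁ ≤ m₁) (hS : (φ (m₁, a₂)).2) :
    a₂ ≤ (φ (m₁, a₂)).1.2 := by
  rcases h with ⟨h, -⟩ | ⟨-, x, -, -, h3, h4⟩
  · exact h.trans (hφ.plane h₁ le_rfl).2.1
  · have hx : x ≤ m₁ := by
      by_contra hx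
      exact h3 ((hφ.plane (not_le.1 hx).le le_rfl).2.2 hS)
    exact h4.trans (hφ.plane hx le_rfl).2.1

theorem PlaneHigh.fst_le {φ : ℤ × ℤ → (ℤ × ℤ) × Prop} (hφ : Monotone φ)
    (h : PlaneHigh φ (b₁, a₂) (b₁, b₂)) (h₂ : m₂ ≤ b₂) (hS : ¬ (φ (b₁, m₂)).2) :
    (φ (b₁, m₂)).1.1 ≤ b₁ := by
  rcases h with ⟨-, y, -, -, h3, h4⟩ | ⟨h, -⟩
  · have hy : m₂ ≤ y := by
      by_contra hy
      exact hS ((hφ.plane le_rfl (not_le.1 hy).le).2.2 h3)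
    exact (hφ.plane le_rfl hy).1.trans h4
  · exact (hφ.plane le_rfl h₂).1.trans h

theorem PlaneHigh.snd_le {φ : ℤ × ℤ → (ℤ × ℤ) × Prop} (hφ : Monotone φ)
    (h : PlaneHigh φ (a₁, b₂) (b₁, b₂)) (h₁ : m₁ ≤ b₁) (hS : ¬ (φ (m₁, b₂)).2) :
    (φ (m₁, b₂)).1.2 ≤ b₂ := by
  rcases h with ⟨h, -⟩ | ⟨-, x, -, -, h3, h4⟩
  · exact (hφ.plane h₁ le_rfl).2.1.trans h
  · have hx : m₁ ≤ x := by
      by_contra hx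
      exact hS ((hφ.plane (not_le.1 hx).le le_rfl).2.2 h3)
    exact (hφ.plane hx le_rfl).2.1.trans h4

/-- The sequence `0, 1, 2, 4, 8, …` of side lengths. -/
def halfPow : ℕ → ℤ
  -- Starting with `0` makes the collapse of a side of length one to a point count as progress.
  | 0 => 0
  | n + 1 => 2 ^ n

theorem halfPow_nonneg (n : ℕ) : 0 ≤ halfPow n := by
  cases n <;> simp [halfPow]

theorem exists_pred_of_one_le_halfPow {n : ℕ} (h : 1 ≤ halfPow n) : ∃ n', n = n' + 1 := by
  cases n with
  | zero => simp [halfPow] at h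
  | succ n => exact ⟨n, rfl⟩

theorem exists_pred_of_two_le_halfPow {n : ℕ} {w : ℤ} (h : 2 ≤ w) (hw : w ≤ halfPow n) :
    ∃ n', n = n' + 1 ∧ w ≤ 2 * halfPow n' := by
  rcases n with - | - | n
  · simp [halfPow] at hw; omega
  · simp [halfPow] at hw; omega
  · refine ⟨n + 1, rfl, ?_⟩
    simp only [halfPow, pow_succ] at hw ⊢
    omega

/-- At most two pivots, ten queries, lower `p + q` by at least one; the final `4` pays for the
corners of a small box. -/
theorem plane_search (N : ℕ) : ∀ p q : ℕ, p + q = N → ∀ a₁ a₂ b₁ b₂ : ℤ,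
    l.1 ≤ a₁ → l.2 ≤ a₂ → b₁ ≤ u.1 → b₂ ≤ u.2 → a₁ ≤ b₁ → a₂ ≤ b₂ →
    b₁ - a₁ ≤ halfPow p → b₂ - a₂ ≤ halfPow q →
    QuerySolvable (Icc l u) (fun z φ => z ∈ Icc l u ∧ IsStarPoint φ z)
      {φ | Monotone φ ∧ PlaneBox φ (a₁, a₂) (b₁, b₂)} (10 * N + 4) := by
  induction N using Nat.strong_induction_on with
  | _ N ih =>
  intro p q hpq a₁ a₂ b₁ b₂ hl₁ hl₂ hu₁ hu₂ h₁ h₂ hp hq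
  have hp₀ := halfPow_nonneg p
  have hq₀ := halfPow_nonneg q
  have step : ∀ p' q', p' + q' < N → ∀ a₁' a₂' b₁' b₂', a₁ ≤ a₁' → a₂ ≤ a₂' → b₁' ≤ b₁ →
      b₂' ≤ b₂ → a₁' ≤ b₁' → a₂' ≤ b₂' → b₁' - a₁' ≤ halfPow p' → b₂' - a₂' ≤ halfPow q' →
      ∀ P : Set (ℤ × ℤ → (ℤ × ℤ) × Prop), (∀ φ ∈ P, Monotone φ ∧
        PlaneBox φ (a₁', a₂') (b₁', b₂')) → ∀ r, 10 * N ≤ r + 6 →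
      QuerySolvable (Icc l u) (fun z φ => z ∈ Icc l u ∧ IsStarPoint φ z) P r := by
    intro p' q' hN a₁' a₂' b₁' b₂' g1 g2 g3 g4 g5 g6 g7 g8 P hP r hr
    exact (ih _ hN p' q' rfl a₁' a₂' b₁' b₂' (by omega) (by omega) (by omega) (by omega) g5 g6 g7
      g8).mono hP (by omega)
  by_cases w₁ : b₁ - a₁ ≤ 1 <;> by_cases w₂ : b₂ - a₂ ≤ 1
  · have : QuerySolvable (Icc l u) (fun z φ => z ∈ Icc l u ∧ IsStarPoint φ z)
        {φ | Monotone φ ∧ PlaneBox φ (a₁, a₂) (b₁, b₂)} (0 + 4) := by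
      refine query_list_star [(a₁, a₂), (a₁, b₂), (b₁, a₂), (b₁, b₂)] ?_ fun φ₀ h₀ hn => ?_
      · simp only [List.mem_cons, List.not_mem_nil, or_false, forall_eq_or_imp, forall_eq, mem_Icc,
          Prod.le_def]
        omega
      · rcases h₀.2.exists_isStarPoint h₀.1 h₁ h₂ (by omega) (by omega) with h | h | h | h <;>
        exact absurd h (hn _ (by simp))
    exact this.mono subset_rfl (by omega)
  · obtain ⟨q, rfl, hq'⟩ := exists_pred_of_two_le_halfPow (by omega) hq
    obtain ⟨m, hm₁, hm₂, hm₃, hm₄⟩ : ∃ m, a₂ ≤ m ∧ m ≤ b₂ ∧ m - a₂ ≤ halfPow q ∧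
      b₂ - m ≤ halfPow q := ⟨(a₂ + b₂) / 2, by omega, by omega, by omega, by omega⟩
    -- A width of at most one may leave no interior abscissa, so the pivot sits on the left side.
    -- The only outcome that need not shrink the box is a pivot outside `S` moving right; then the
    -- opposite pivot on the right side is used.
    refine (plane_pivot (m₁ := a₁) (m₂ := m) (q := 10 * N - 1) (fun φ hφ => hφ.1)
      (fun φ hφ => hφ.2) hl₁ hl₂ hu₁ hu₂ le_rfl h₁ hm₁ hm₂ ?_ ?_ ?_ ?_ ?_ ?_).mono
      subset_rfl (by omega)
    · by_cases w : a₁ = b₁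
      · subst w
        refine .of_isEmpty ?_
        rintro φ ⟨⟨g1, g2⟩, g3, g4, g5⟩
        exact absurd (g3.1.le_fst g1 hm₁ g4) (by omega)
      · obtain ⟨p, rfl⟩ := exists_pred_of_one_le_halfPow (n := p) (by omega)
        have := halfPow_nonneg p
        exact step p (q + 1) (by omega) a₁ a₂ a₁ b₂ le_rfl le_rfl h₁ le_rfl le_rfl h₂ (by omega)
          hq _ (fun φ hφ => ⟨hφ.1.1, hφ.2.1⟩) _ (by omega)
    · exact step p q (by omega) a₁ a₂ b₁ m le_rfl le_rfl le_rfl hm₂ h₁ hm₁ hp hm₃ _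
        (fun φ hφ => ⟨hφ.1.1, hφ.2.1⟩) _ (by omega)
    · exact step p q (by omega) a₁ a₂ a₁ m le_rfl le_rfl h₁ hm₂ le_rfl hm₁ (by omega) hm₃ _
        (fun φ hφ => ⟨hφ.1.1, hφ.2⟩) _ (by omega)
    · refine (plane_pivot (m₁ := b₁) (m₂ := m) (q := 10 * N - 6) (fun φ hφ => hφ.1.1)
        (fun φ hφ => hφ.1.2) hl₁ hl₂ hu₁ hu₂ h₁ le_rfl hm₁ hm₂ ?_ ?_ ?_ ?_ ?_ ?_).mono
        subset_rfl (by omega)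
      · refine .of_isEmpty ?_
        rintro φ ⟨⟨⟨g1, g2⟩, g3, g4, g5⟩, g6, g7, g8⟩
        -- Both pivots failing would give `a₁ < f₁(a₁, m) ≤ f₁(b₁, m) < b₁`, impossible for width at
        -- most one.
        have := (g1.plane h₁ (le_refl m)).1
        omega
      · exact step p q (by omega) a₁ a₂ b₁ m le_rfl le_rfl le_rfl hm₂ h₁ hm₁ hp hm₃ _
          (fun φ hφ => ⟨hφ.1.1.1, hφ.2.1⟩) _ (by omega)
      · exact step p q (by omega) a₁ a₂ b₁ m le_rfl le_rfl le_rfl hm₂ h₁ hm₁ hp hm₃ _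
          (fun φ hφ => ⟨hφ.1.1.1, hφ.2⟩) _ (by omega)
      · by_cases w : a₁ = b₁
        · subst w
          refine .of_isEmpty ?_
          rintro φ ⟨⟨⟨g1, g2⟩, -⟩, g3, g4, g5⟩
          exact absurd (g3.2.fst_le g1 hm₂ g4) (by omega)
        · obtain ⟨p, rfl⟩ := exists_pred_of_one_le_halfPow (n := p) (by omega)
          have := halfPow_nonneg p
          exact step p (q + 1) (by omega) b₁ a₂ b₁ b₂ h₁ le_rfl le_rfl le_rfl le_rfl h₂ (by omega)
            hq _ (fun φ hφ => ⟨hφ.1.1.1, hφ.2.1⟩) _ (by omega)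
      · exact step p q (by omega) a₁ m b₁ b₂ le_rfl hm₁ le_rfl le_rfl h₁ hm₂ hp hm₄ _
          (fun φ hφ => ⟨hφ.1.1.1, hφ.2.1⟩) _ (by omega)
      · exact step p q (by omega) b₁ m b₁ b₂ h₁ hm₁ le_rfl le_rfl le_rfl hm₂ (by omega) hm₄ _
          (fun φ hφ => ⟨hφ.1.1.1, hφ.2⟩) _ (by omega)
    · exact step p q (by omega) a₁ m b₁ b₂ le_rfl hm₁ le_rfl le_rfl h₁ hm₂ hp hm₄ _
        (fun φ hφ => ⟨hφ.1.1, hφ.2.1⟩) _ (by omega)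
    · exact step p q (by omega) a₁ m b₁ b₂ le_rfl hm₁ le_rfl le_rfl h₁ hm₂ hp hm₄ _
        (fun φ hφ => ⟨hφ.1.1, hφ.2⟩) _ (by omega)
  · obtain ⟨p, rfl, hp'⟩ := exists_pred_of_two_le_halfPow (by omega) hp
    obtain ⟨m, hm₁, hm₂, hm₃, hm₄⟩ : ∃ m, a₁ ≤ m ∧ m ≤ b₁ ∧ m - a₁ ≤ halfPow p ∧
      b₁ - m ≤ halfPow p := ⟨(a₁ + b₁) / 2, by omega, by omega, by omega, by omega⟩
    refine (plane_pivot (m₁ := m) (m₂ := a₂) (q := 10 * N - 1) (fun φ hφ => hφ.1)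
      (fun φ hφ => hφ.2) hl₁ hl₂ hu₁ hu₂ hm₁ hm₂ le_rfl h₂ ?_ ?_ ?_ ?_ ?_ ?_).mono
      subset_rfl (by omega)
    · exact step p q (by omega) a₁ a₂ m b₂ le_rfl le_rfl hm₂ le_rfl hm₁ h₂ hm₃ hq _
        (fun φ hφ => ⟨hφ.1.1, hφ.2.1⟩) _ (by omega)
    · by_cases w : a₂ = b₂
      · subst w
        refine .of_isEmpty ?_
        rintro φ ⟨⟨g1, g2⟩, g3, g4, g5⟩
        exact absurd (g3.1.le_snd g1 hm₁ g4) (by omega)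
      · obtain ⟨q, rfl⟩ := exists_pred_of_one_le_halfPow (n := q) (by omega)
        have := halfPow_nonneg q
        exact step (p + 1) q (by omega) a₁ a₂ b₁ a₂ le_rfl le_rfl le_rfl h₂ h₁ le_rfl hp (by omega)
          _ (fun φ hφ => ⟨hφ.1.1, hφ.2.1⟩) _ (by omega)
    · exact step p q (by omega) a₁ a₂ m a₂ le_rfl le_rfl hm₂ h₂ hm₁ le_rfl hm₃ (by omega) _
        (fun φ hφ => ⟨hφ.1.1, hφ.2⟩) _ (by omega)
    · exact step p q (by omega) m a₂ b₁ b₂ hm₁ le_rfl le_rfl le_rfl hm₂ h₂ hm₄ hq _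
        (fun φ hφ => ⟨hφ.1.1, hφ.2.1⟩) _ (by omega)
    · refine (plane_pivot (m₁ := m) (m₂ := b₂) (q := 10 * N - 6) (fun φ hφ => hφ.1.1)
        (fun φ hφ => hφ.1.2) hl₁ hl₂ hu₁ hu₂ hm₁ hm₂ h₂ le_rfl ?_ ?_ ?_ ?_ ?_ ?_).mono
        subset_rfl (by omega)
      · exact step p q (by omega) a₁ a₂ m b₂ le_rfl le_rfl hm₂ le_rfl hm₁ h₂ hm₃ hq _
          (fun φ hφ => ⟨hφ.1.1.1, hφ.2.1⟩) _ (by omega)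
      · refine .of_isEmpty ?_
        rintro φ ⟨⟨⟨g1, g2⟩, g3, g4, g5⟩, g6, g7, g8⟩
        have := (g1.plane (le_refl m) h₂).2.1
        omega
      · exact step p q (by omega) a₁ a₂ m b₂ le_rfl le_rfl hm₂ le_rfl hm₁ h₂ hm₃ hq _
          (fun φ hφ => ⟨hφ.1.1.1, hφ.2⟩) _ (by omega)
      · exact step p q (by omega) m a₂ b₁ b₂ hm₁ le_rfl le_rfl le_rfl hm₂ h₂ hm₄ hq _
          (fun φ hφ => ⟨hφ.1.1.1, hφ.2.1⟩) _ (by omega)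
      · by_cases w : a₂ = b₂
        · subst w
          refine .of_isEmpty ?_
          rintro φ ⟨⟨⟨g1, g2⟩, -⟩, g3, g4, g5⟩
          exact absurd (g3.2.snd_le g1 hm₂ g4) (by omega)
        · obtain ⟨q, rfl⟩ := exists_pred_of_one_le_halfPow (n := q) (by omega)
          have := halfPow_nonneg q
          exact step (p + 1) q (by omega) a₁ b₂ b₁ b₂ le_rfl h₂ le_rfl le_rfl h₁ le_rfl hp
            (by omega) _ (fun φ hφ => ⟨hφ.1.1.1, hφ.2.1⟩) _ (by omega)
      · exact step p q (by omega) m b₂ b₁ b₂ hm₁ h₂ le_rfl le_rfl hm₂ le_rfl hm₄ (by omega) _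
          (fun φ hφ => ⟨hφ.1.1.1, hφ.2⟩) _ (by omega)
    · exact step p q (by omega) m a₂ b₁ b₂ hm₁ le_rfl le_rfl le_rfl hm₂ h₂ hm₄ hq _
        (fun φ hφ => ⟨hφ.1.1, hφ.2⟩) _ (by omega)
  · obtain ⟨p, rfl, hp'⟩ := exists_pred_of_two_le_halfPow (by omega) hp
    obtain ⟨q, rfl, hq'⟩ := exists_pred_of_two_le_halfPow (by omega) hq
    have hp₁ := halfPow_nonneg p
    obtain ⟨m, hm₁, hm₂, hm₃, hm₄⟩ : ∃ m, a₁ ≤ m ∧ m ≤ b₁ ∧ m - a₁ ≤ halfPow p ∧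
      b₁ - m ≤ halfPow p := ⟨(a₁ + b₁) / 2, by omega, by omega, by omega, by omega⟩
    obtain ⟨n, hn₁, hn₂, hn₃, hn₄⟩ : ∃ m, a₂ ≤ m ∧ m ≤ b₂ ∧ m - a₂ ≤ halfPow q ∧
      b₂ - m ≤ halfPow q := ⟨(a₂ + b₂) / 2, by omega, by omega, by omega, by omega⟩
    refine (plane_pivot (m₁ := m) (m₂ := n) (q := 10 * N - 1) (fun φ hφ => hφ.1)
      (fun φ hφ => hφ.2) hl₁ hl₂ hu₁ hu₂ hm₁ hm₂ hn₁ hn₂ ?_ ?_ ?_ ?_ ?_ ?_).mono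
      subset_rfl (by omega)
    · exact step p (q + 1) (by omega) a₁ a₂ m b₂ le_rfl le_rfl hm₂ le_rfl hm₁ h₂ hm₃ hq _
        (fun φ hφ => ⟨hφ.1.1, hφ.2.1⟩) _ (by omega)
    · exact step (p + 1) q (by omega) a₁ a₂ b₁ n le_rfl le_rfl le_rfl hn₂ h₁ hn₁ hp hn₃ _
        (fun φ hφ => ⟨hφ.1.1, hφ.2.1⟩) _ (by omega)
    · exact step p q (by omega) a₁ a₂ m n le_rfl le_rfl hm₂ hn₂ hm₁ hn₁ hm₃ hn₃ _
        (fun φ hφ => ⟨hφ.1.1, hφ.2⟩) _ (by omega)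
    · exact step p (q + 1) (by omega) m a₂ b₁ b₂ hm₁ le_rfl le_rfl le_rfl hm₂ h₂ hm₄ hq _
        (fun φ hφ => ⟨hφ.1.1, hφ.2.1⟩) _ (by omega)
    · exact step (p + 1) q (by omega) a₁ n b₁ b₂ le_rfl hn₁ le_rfl le_rfl h₁ hn₂ hp hn₄ _
        (fun φ hφ => ⟨hφ.1.1, hφ.2.1⟩) _ (by omega)
    · exact step p q (by omega) m n b₁ b₂ hm₁ hn₁ le_rfl le_rfl hm₂ hn₂ hm₄ hn₄ _
        (fun φ hφ => ⟨hφ.1.1, hφ.2⟩) _ (by omega)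

end Plane

/-- In the plane, the relaxed Tarski problem needs only logarithmically many queries. -/
theorem starSolvable_plane {l u : ℤ × ℤ} (hlu : l ≤ u) {L : ℕ} (h₁ : u.1 - l.1 < 2 ^ L)
    (h₂ : u.2 - l.2 < 2 ^ L) : StarSolvable l u (20 * L + 26) := by
  have hlu' : l.1 ≤ u.1 ∧ l.2 ≤ u.2 := hlu
  have key := plane_search (l := l) (u := u) (2 * (L + 1)) (L + 1) (L + 1) (by omega) l.1 l.2 u.1
    u.2 le_rfl le_rfl le_rfl le_rfl hlu'.1 hlu'.2 h₁.le h₂.le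
  refine QuerySolvable.mono (q := 10 * (2 * (L + 1)) + 4 + 2) (P := starClass l u) ?_ subset_rfl
    (by omega)
  -- If neither corner is a star point, then `l ∉ S` and `u ∈ S`, and the corners themselves serve
  -- as the initial certificates.
  refine query_list_star [l, u] ?_ fun φ₀ h₀ hn => ?_
  · simp [hlu]
  refine key.mono ?_ le_rfl
  rintro φ ⟨⟨g1, g2, g3⟩, g4⟩
  have n₁ : ¬ IsStarPoint φ l := fun h => hn l (by simp) ((isStarPoint_congr (g4 l (by simp))).1 h)
  have n₂ : ¬ IsStarPoint φ u := fun h => hn u (by simp) ((isStarPoint_congr (g4 u (by simp))).1 h)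
  have hl : ¬ (φ l).2 := fun h => n₁ (Or.inl ⟨g2, h⟩)
  have hu : (φ u).2 := by
    by_contra h
    exact n₂ (Or.inr ⟨g3, h⟩)
  exact ⟨g1, Or.inl ⟨g2.2, l.2, le_rfl, hlu'.2, hl, g2.1⟩,
    Or.inl ⟨g3.2, u.2, hlu'.2, le_rfl, hu, g3.1⟩⟩

/-! ### Tests on the fibres of a product -/

section Search

variable {X Y : Type*} {A B A' B' : Set (X × Y)} {φ : X × Y → (X × Y) × Prop} {x : X}

/-- The part of the answer of `φ` that does not concern the fibre. -/
def baseValue (φ : X × Y → (X × Y) × Prop) (z : X × Y) : X × Prop :=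
  ((φ z).1.1, (φ z).2)

/-- The sets `A`, `B` prove the truth value `t` of the test `κ` on the fibre over `x`. -/
def IsTested (φ : X × Y → (X × Y) × Prop) (A B : Set (X × Y)) (x : X) (κ : X × Prop → Prop)
    (t : Prop) : Prop :=
  (t → ∃ y, (x, y) ∈ A ∧ κ (baseValue φ (x, y))) ∧
    (¬ t → ∃ y, (x, y) ∈ B ∧ ¬ κ (baseValue φ (x, y)))

theorem IsTested.mono {κ : X × Prop → Prop} {t : Prop} (h : IsTested φ A B x κ t) (hA : A ⊆ A')
    (hB : B ⊆ B') : IsTested φ A' B' x κ t :=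
  ⟨fun ht => (h.1 ht).imp fun _ h => ⟨hA h.1, h.2⟩,
    fun ht => (h.2 ht).imp fun _ h => ⟨hB h.1, h.2⟩⟩

/-- The sets `A`, `B` prove that the coordinate `g`, rounded towards `c`, has a value `v` on the
fibre over `x`. -/
def IsRounded (g : X × Y → ℤ) (A B : Set (X × Y)) (x : X) (c v : ℤ) : Prop :=
  c - 1 ≤ v ∧ v ≤ c + 1 ∧ (c ≤ v → ∃ y, (x, y) ∈ A ∧ v ≤ g (x, y)) ∧
    (v ≤ c → ∃ y, (x, y) ∈ B ∧ g (x, y) ≤ v)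

theorem IsRounded.mono {g : X × Y → ℤ} {c v : ℤ} (h : IsRounded g A B x c v) (hA : A ⊆ A')
    (hB : B ⊆ B') : IsRounded g A' B' x c v :=
  ⟨h.1, h.2.1, fun ht => (h.2.2.1 ht).imp fun _ h => ⟨hA h.1, h.2⟩,
    fun ht => (h.2.2.2 ht).imp fun _ h => ⟨hB h.1, h.2⟩⟩

/-- Two threshold tests separate the cases above, at and below `c`. The value is chosen before `φ`
because the algorithm knows only the outcomes of the tests. -/
theorem exists_isRounded (g : X × Prop → ℤ) (c : ℤ) {t₁ t₂ : Prop} :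
    ∃ v, ∀ φ : X × Y → (X × Y) × Prop, IsTested φ A B x (fun r => c + 1 ≤ g r) t₁ →
      IsTested φ A B x (fun r => c ≤ g r) t₂ →
      IsRounded (fun z => g (baseValue φ z)) A B x c v := by
  by_cases h₁ : t₁
  · refine ⟨c + 1, fun φ k₁ k₂ => ⟨by omega, by omega, fun _ => k₁.1 h₁, fun h => by omega⟩⟩
  by_cases h₂ : t₂
  · refine ⟨c, fun φ k₁ k₂ => ⟨by omega, by omega, fun _ => k₂.1 h₂, fun _ => ?_⟩⟩
    exact (k₁.2 h₁).imp fun y hy => ⟨hy.1, by have := hy.2; dsimp only; omega⟩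
  · refine ⟨c - 1, fun φ k₁ k₂ => ⟨by omega, by omega, fun h => by omega, fun _ => ?_⟩⟩
    exact (k₂.2 h₂).imp fun y hy => ⟨hy.1, by have := hy.2; dsimp only; omega⟩

variable [Preorder X] [ConditionallyCompleteLattice Y] {lx ux : X} {ly uy : Y} {q : ℕ}

/-- Sets `A` of lower and `B` of upper search points in the box that are separated along fibres. -/
structure IsSeparated (lx ux : X) (ly uy : Y) (A B : Set (X × Y)) : Prop where
  bot_mem : (lx, ly) ∈ A
  top_mem : (ux, uy) ∈ B
  left_le : ∀ z ∈ A, z.2 ≤ uy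
  le_right : ∀ z ∈ B, ly ≤ z.2
  le_of_le : ∀ a ∈ A, ∀ b ∈ B, a.1 ≤ b.1 → a.2 ≤ b.2

/-- In the second component, `φ` is post-fixed on `A` and pre-fixed on `B`. -/
def IsFibrewise (φ : X × Y → (X × Y) × Prop) (A B : Set (X × Y)) : Prop :=
  (∀ z ∈ A, z.2 ≤ (φ z).1.2) ∧ ∀ z ∈ B, (φ z).1.2 ≤ z.2

/-- The join of the lower search points below a fibre. -/
noncomputable def lowerEnd (A : Set (X × Y)) (x : X) : Y :=
  sSup {y | ∃ x₀ ≤ x, (x₀, y) ∈ A}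

/-- The meet of the upper search points above a fibre. -/
noncomputable def upperEnd (B : Set (X × Y)) (x : X) : Y :=
  sInf {y | ∃ x₀, x ≤ x₀ ∧ (x₀, y) ∈ B}

namespace IsSeparated

variable (h : IsSeparated lx ux ly uy A B)
include h

theorem le_lowerEnd {x₀ : X} {y : Y} (hx : x₀ ≤ x) (hy : (x₀, y) ∈ A) : y ≤ lowerEnd A x :=
  le_csSup ⟨uy, by rintro _ ⟨x₁, -, h₁⟩; exact h.left_le _ h₁⟩ ⟨x₀, hx, hy⟩

theorem upperEnd_le {x₀ : X} {y : Y} (hx : x ≤ x₀) (hy : (x₀, y) ∈ B) : upperEnd B x ≤ y :=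
  csInf_le ⟨ly, by rintro _ ⟨x₁, -, h₁⟩; exact h.le_right _ h₁⟩ ⟨x₀, hx, hy⟩

theorem lowerEnd_le (hx : lx ≤ x) {c : Y} (hc : ∀ z ∈ A, z.1 ≤ x → z.2 ≤ c) :
    lowerEnd A x ≤ c :=
  csSup_le ⟨ly, lx, hx, h.bot_mem⟩ (by rintro y ⟨x₀, h₀, h₁⟩; exact hc _ h₁ h₀)

theorem le_upperEnd (hx : x ≤ ux) {c : Y} (hc : ∀ z ∈ B, x ≤ z.1 → c ≤ z.2) :
    c ≤ upperEnd B x :=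
  le_csInf ⟨uy, ux, hx, h.top_mem⟩ (by rintro y ⟨x₀, h₀, h₁⟩; exact hc _ h₁ h₀)

theorem lowerEnd_le_upperEnd (hx : x ∈ Icc lx ux) : lowerEnd A x ≤ upperEnd B x :=
  h.lowerEnd_le hx.1 fun a ha h₀ => h.le_upperEnd hx.2 fun b hb h₁ =>
    h.le_of_le a ha b hb (h₀.trans h₁)

theorem le_lowerEnd_bot (hx : lx ≤ x) : ly ≤ lowerEnd A x :=
  h.le_lowerEnd hx h.bot_mem

theorem upperEnd_le_top (hx : x ≤ ux) : upperEnd B x ≤ uy :=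
  h.upperEnd_le hx h.top_mem

/-- Each recorded lower point satisfies `z.2 ≤ (φ z).1.2`, which monotonicity carries to the fibre
over `x`; the bound passes to the supremum. Hence the interval between the two ends is a valid box
for a fibre search. -/
theorem lowerEnd_le_map (hx : lx ≤ x) (hφ : Monotone φ) (hf : IsFibrewise φ A B) :
    lowerEnd A x ≤ (φ (x, lowerEnd A x)).1.2 :=
  h.lowerEnd_le hx fun z hz h₀ => (hf.1 z hz).trans
    (hφ (Prod.mk_le_mk.2 ⟨h₀, h.le_lowerEnd h₀ hz⟩ : z ≤ _)).1.2

theorem map_le_upperEnd (hx : x ≤ ux) (hφ : Monotone φ) (hf : IsFibrewise φ A B) :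
    (φ (x, upperEnd B x)).1.2 ≤ upperEnd B x :=
  h.le_upperEnd hx fun z hz h₀ =>
    (hφ (Prod.mk_le_mk.2 ⟨h₀, h.upperEnd_le h₀ hz⟩ : _ ≤ z)).1.2.trans (hf.2 z hz)

/-- Any upper point whose base is above `x` already takes part in the infimum `upperEnd B x`, hence
lies above `y`. -/
theorem insert_left (hx : x ∈ Icc lx ux) {y : Y} (hy : y ≤ upperEnd B x) :
    IsSeparated lx ux ly uy (insert (x, y) A) B where
  bot_mem := Or.inr h.bot_mem
  top_mem := h.top_mem
  left_le := by
    rintro z (rfl | hz)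
    · exact hy.trans (h.upperEnd_le_top hx.2)
    · exact h.left_le z hz
  le_right := h.le_right
  le_of_le := by
    rintro a (rfl | ha) b hb hab
    · exact hy.trans (h.upperEnd_le hab hb)
    · exact h.le_of_le a ha b hb hab

theorem insert_right (hx : x ∈ Icc lx ux) {y : Y} (hy : lowerEnd A x ≤ y) :
    IsSeparated lx ux ly uy A (insert (x, y) B) where
  bot_mem := h.bot_mem
  top_mem := Or.inr h.top_mem
  left_le := h.left_le
  le_right := by
    rintro z (rfl | hz)
    · exact (h.le_lowerEnd_bot hx.1).trans hy
    · exact h.le_right z hz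
  le_of_le := by
    rintro a ha b (rfl | hb) hab
    · exact (h.le_lowerEnd hab ha).trans hy
    · exact h.le_of_le a ha b hb hab

end IsSeparated

theorem Monotone.baseValue (hφ : Monotone φ) : Monotone (baseValue φ) :=
  fun _ _ h => ⟨(hφ h).1.1, (hφ h).2⟩

/-- One test on one fibre costs one relaxed Tarski search in the fibre. -/
theorem querySolvable_test
    (hY : ∀ l u : Y, ly ≤ l → l ≤ u → u ≤ uy → StarSolvable l u q)
    (h : IsSeparated lx ux ly uy A B) (hx : x ∈ Icc lx ux) {κ : X × Prop → Prop}
    (hκ : Monotone κ) :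
    QuerySolvable (Icc (lx, ly) (ux, uy))
      (fun (o : Set (X × Y) × Set (X × Y) × Prop) φ => IsSeparated lx ux ly uy o.1 o.2.1 ∧
        IsFibrewise φ o.1 o.2.1 ∧ A ⊆ o.1 ∧ B ⊆ o.2.1 ∧ IsTested φ o.1 o.2.1 x κ o.2.2)
      {φ | Monotone φ ∧ IsFibrewise φ A B} (q + 1) := by
  have hl := h.le_lowerEnd_bot hx.1
  have hu := h.upperEnd_le_top hx.2
  have hsearch := QuerySolvable.comap (X' := Icc (lx, ly) (ux, uy))
    (P' := {φ | Monotone φ ∧ IsFibrewise φ A B})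
    (hY _ _ hl (h.lowerEnd_le_upperEnd hx) hu)
    (fun φ y => ((φ (x, y)).1.2, κ (baseValue φ (x, y)))) (fun y => (x, y))
    (fun _ r => (r.1.2, κ (r.1.1, r.2))) (fun _ _ => rfl)
    (fun y hy => ⟨Prod.mk_le_mk.2 ⟨hx.1, hl.trans hy.1⟩, Prod.mk_le_mk.2 ⟨hx.2, hy.2.trans hu⟩⟩)
    (by
      rintro φ ⟨h1, h2⟩
      refine ⟨fun y y' hy => ?_, h.lowerEnd_le_map hx.1 h1 h2, h.map_le_upperEnd hx.2 h1 h2⟩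
      have hxy : (x, y) ≤ (x, y') := Prod.mk_le_mk.2 ⟨le_rfl, hy⟩
      exact ⟨(h1 hxy).1.2, hκ (h1.baseValue hxy)⟩)
  have : Nonempty (Set (X × Y) × Set (X × Y) × Prop) := ⟨(A, B, True)⟩
  refine hsearch.bind fun y => ?_
  by_cases hy : y ∈ Icc (lowerEnd A x) (upperEnd B x)
  swap
  · exact .of_isEmpty fun φ hφ => hy hφ.2.1
  -- The search returns a star point without saying of which kind; one more query decides whether it
  -- joins `A` or `B`.
  refine QuerySolvable.query_of_mem (q := 0) (x, y)
    ⟨Prod.mk_le_mk.2 ⟨hx.1, hl.trans hy.1⟩, Prod.mk_le_mk.2 ⟨hx.2, hy.2.trans hu⟩⟩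
    fun φ₀ h₀ => ?_
  rcases h₀.2.2 with hs | hs
  · refine .output (insert (x, y) A, B, True) ?_
    rintro φ ⟨⟨⟨h1, h2⟩, -⟩, h4⟩
    have hs1 : y ≤ (φ (x, y)).1.2 := by rw [h4]; exact hs.1
    have hs2 : κ (baseValue φ (x, y)) := by
      rw [baseValue, h4]; exact hs.2
    refine ⟨h.insert_left hx hy.2, ⟨?_, h2.2⟩, subset_insert _ _, subset_rfl,
      fun _ => ⟨y, mem_insert _ _, hs2⟩, fun h => absurd trivial h⟩
    rintro z (rfl | hz)
    · exact hs1
    · exact h2.1 z hz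
  · refine .output (A, insert (x, y) B, False) ?_
    rintro φ ⟨⟨⟨h1, h2⟩, -⟩, h4⟩
    have hs1 : (φ (x, y)).1.2 ≤ y := by rw [h4]; exact hs.1
    have hs2 : ¬ κ (baseValue φ (x, y)) := by
      rw [baseValue, h4]; exact hs.2
    refine ⟨h.insert_right hx hy.1, ⟨h2.1, ?_⟩, subset_rfl, subset_insert _ _,
      fun h => h.elim, fun _ => ⟨y, mem_insert _ _, hs2⟩⟩
    rintro z (rfl | hz)
    · exact hs1
    · exact h2.2 z hz

/-- Several tests on one fibre. -/
theorem querySolvable_tests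
    (hY : ∀ l u : Y, ly ≤ l → l ≤ u → u ≤ uy → StarSolvable l u q)
    (h : IsSeparated lx ux ly uy A B) (hx : x ∈ Icc lx ux) {κ : ℕ → X × Prop → Prop}
    (hκ : ∀ i, Monotone (κ i)) (N : ℕ) :
    QuerySolvable (Icc (lx, ly) (ux, uy))
      (fun (o : Set (X × Y) × Set (X × Y) × (ℕ → Prop)) φ => IsSeparated lx ux ly uy o.1 o.2.1 ∧
        IsFibrewise φ o.1 o.2.1 ∧ A ⊆ o.1 ∧ B ⊆ o.2.1 ∧
        ∀ i < N, IsTested φ o.1 o.2.1 x (κ i) (o.2.2 i))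
      {φ | Monotone φ ∧ IsFibrewise φ A B} (N * (q + 1)) := by
  induction N with
  | zero =>
    exact .output (A, B, fun _ => True) fun φ hφ => ⟨h, hφ.2, subset_rfl, subset_rfl, by simp⟩
  | succ N ih =>
    rw [Nat.succ_mul]
    refine ih.bind fun o => ?_
    by_cases ho : IsSeparated lx ux ly uy o.1 o.2.1
    swap
    · have : Nonempty (Set (X × Y) × Set (X × Y) × (ℕ → Prop)) := ⟨o⟩
      exact .of_isEmpty fun φ hφ => ho hφ.2.1
    refine ((querySolvable_test hY ho hx (hκ N)).mono (fun φ hφ => ⟨hφ.1.1, hφ.2.2.1⟩)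
      le_rfl).map (fun o' => (o'.1, o'.2.1, fun i => if i < N then o.2.2 i else o'.2.2)) ?_
    rintro o' φ ⟨⟨g1, -⟩, -, -, g4, g5, g6⟩ ⟨k1, k2, k3, k4, k5⟩
    refine ⟨k1, k2, g4.trans k3, g5.trans k4, fun i hi => ?_⟩
    by_cases hi' : i < N
    · simpa [hi'] using (g6 i hi').mono k3 k4
    · obtain rfl : i = N := by omega
      simpa using k5

/-- If `v' < v`, rounding to within one of `c ≤ c'` forces `c ≤ v` and `v' ≤ c'`. So there are a
lower witness over `x` and an upper witness over `x'`; separation orders them, and monotonicity of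
`g` gives a contradiction. -/
theorem IsRounded.le (hs : IsSeparated lx ux ly uy A B) {g : X × Y → ℤ} (hg : Monotone g)
    {x x' : X} {c v c' v' : ℤ} (h : IsRounded g A B x c v) (h' : IsRounded g A B x' c' v')
    (hx : x ≤ x') (hc : c ≤ c') : v ≤ v' := by
  by_contra hv
  obtain ⟨y, hy, hy'⟩ := h.2.2.1 (by have := h'.1; omega)
  obtain ⟨z, hz, hz'⟩ := h'.2.2.2 (by have := h.2.1; omega)
  have := hg (Prod.mk_le_mk.2 ⟨hx, hs.le_of_le _ hy _ hz hx⟩ : (x, y) ≤ (x', z))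
  omega

theorem IsRounded.mem_Icc (hs : IsSeparated lx ux ly uy A B) {g : X × Y → ℤ} (hg : Monotone g)
    {c v a b : ℤ} (hx : x ∈ Icc lx ux) (h : IsRounded g A B x c v) (ha : a ≤ g (lx, ly))
    (hb : g (ux, uy) ≤ b) (hc : c ∈ Icc a b) : v ∈ Icc a b := by
  obtain ⟨h1, h2, h3, h4⟩ := h
  obtain ⟨hc1, hc2⟩ := hc
  rcases lt_trichotomy v c with hv | hv | hv
  · obtain ⟨y, hy, hy'⟩ := h4 hv.le
    have := hg (Prod.mk_le_mk.2 ⟨hx.1, hs.le_right _ hy⟩ : (lx, ly) ≤ (x, y))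
    exact ⟨by omega, by omega⟩
  · exact ⟨by omega, by omega⟩
  · obtain ⟨y, hy, hy'⟩ := h3 hv.le
    have := hg (Prod.mk_le_mk.2 ⟨hx.2, hs.left_le _ hy⟩ : (x, y) ≤ (ux, uy))
    exact ⟨by omega, by omega⟩

end Search

/-! ### Simulating a planar search on a product -/

section Compose

variable {Y : Type*} {A B A' B' : Set ((ℤ × ℤ) × Y)}
  {φ : (ℤ × ℤ) × Y → ((ℤ × ℤ) × Y) × Prop} {x : ℤ × ℤ}

/-- The sets `A`, `B` justify the answer `r` of the simulated planar oracle at `x`. -/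
def IsAnswer (φ : (ℤ × ℤ) × Y → ((ℤ × ℤ) × Y) × Prop) (A B : Set ((ℤ × ℤ) × Y)) (x : ℤ × ℤ)
    (r : (ℤ × ℤ) × Prop) : Prop :=
  IsRounded (fun z => (φ z).1.1.1) A B x x.1 r.1.1 ∧
    IsRounded (fun z => (φ z).1.1.2) A B x x.2 r.1.2 ∧ IsTested φ A B x (fun v => v.2) r.2

theorem IsAnswer.mono {r : (ℤ × ℤ) × Prop} (h : IsAnswer φ A B x r) (hA : A ⊆ A')
    (hB : B ⊆ B') : IsAnswer φ A' B' x r :=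
  ⟨h.1.mono hA hB, h.2.1.mono hA hB, h.2.2.mono hA hB⟩

/-- A consistent set of answers extends to an oracle of the planar class. -/
theorem exists_starClass_extension {l u : ℤ × ℤ} {D : Set ((ℤ × ℤ) × ((ℤ × ℤ) × Prop))}
    (hlu : l ≤ u) (hD : ∀ d ∈ D, d.2.1 ∈ Icc l u)
    (hmono : ∀ d ∈ D, ∀ d' ∈ D, d.1 ≤ d'.1 → d.2 ≤ d'.2) :
    ∃ Φ ∈ starClass l u, ∀ d ∈ D, Φ d.1 = d.2 := by
  have aux : ∀ (g : ℤ × ℤ → ℤ), Monotone g → ∃ F : ℤ × ℤ → ℤ, Monotone F ∧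
      (∀ x, g l ≤ F x ∧ F x ≤ g u) ∧ ∀ d ∈ D, F d.1 = g d.2.1 := by
    intro g hg
    -- The extension is the supremum of the recorded values below `x`; the default `g l` keeps it
    -- defined and inside the box, which yields the two corner conditions.
    let T : ℤ × ℤ → Set ℤ := fun x => insert (g l) {v | ∃ d ∈ D, d.1 ≤ x ∧ v = g d.2.1}
    have hT : ∀ x, ∀ v ∈ T x, v ≤ g u := by
      rintro x v (rfl | ⟨d, hd, -, rfl⟩)
      · exact hg hlu
      · exact hg (hD d hd).2
    have hb : ∀ x, BddAbove (T x) := fun x => ⟨g u, hT x⟩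
    have hne : ∀ x, (T x).Nonempty := fun x => ⟨g l, mem_insert _ _⟩
    refine ⟨fun x => sSup (T x), fun x x' hx => csSup_le_csSup (hb x') (hne x) ?_,
      fun x => ⟨le_csSup (hb x) (mem_insert _ _), csSup_le (hne x) (hT x)⟩, fun d hd => ?_⟩
    · exact insert_subset_insert fun v ⟨d, hd, h, e⟩ => ⟨d, hd, h.trans hx, e⟩
    · refine le_antisymm (csSup_le (hne _) ?_) (le_csSup (hb _) (Or.inr ⟨d, hd, le_rfl, rfl⟩))
      rintro v (rfl | ⟨d', hd', h, rfl⟩)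
      · exact hg (hD d hd).1
      · exact hg (hmono d' hd' d hd h).1
  obtain ⟨F, hF, hF', hF''⟩ := aux Prod.fst monotone_fst
  obtain ⟨G, hG, hG', hG''⟩ := aux Prod.snd monotone_snd
  refine ⟨fun x => ((F x, G x), ∃ d ∈ D, d.1 ≤ x ∧ d.2.2), ⟨fun x x' hx => ⟨⟨hF hx, hG hx⟩, ?_⟩,
    ⟨(hF' l).1, (hG' l).1⟩, ⟨(hF' u).2, (hG' u).2⟩⟩, fun d hd => ?_⟩
  · rintro ⟨d, hd, h, h'⟩
    exact ⟨d, hd, h.trans hx, h'⟩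
  · refine Prod.ext (Prod.ext (hF'' d hd) (hG'' d hd)) (propext ⟨?_, fun h => ⟨d, hd, le_rfl, h⟩⟩)
    rintro ⟨d', hd', h, h'⟩
    exact (hmono d' hd' d hd h).2 h'

variable [ConditionallyCompleteLattice Y] {lx ux : ℤ × ℤ} {ly uy : Y} {q : ℕ}

theorem IsAnswer.le (hs : IsSeparated lx ux ly uy A B) (hφ : Monotone φ) {x x' : ℤ × ℤ}
    {r r' : (ℤ × ℤ) × Prop} (h : IsAnswer φ A B x r) (h' : IsAnswer φ A B x' r') (hx : x ≤ x') :
    r ≤ r' := by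
  refine ⟨⟨h.1.le hs (fun a b hab => (hφ hab).1.1.1) h'.1 hx hx.1,
    h.2.1.le hs (fun a b hab => (hφ hab).1.1.2) h'.2.1 hx hx.2⟩, fun hr => ?_⟩
  by_contra hr'
  obtain ⟨y, hy, hy'⟩ := h.2.2.1 hr
  obtain ⟨z, hz, hz'⟩ := h'.2.2.2 hr'
  exact hz' ((hφ (Prod.mk_le_mk.2 ⟨hx, hs.le_of_le _ hy _ hz hx⟩ : (x, y) ≤ (x', z))).2 hy')

theorem IsAnswer.mem_Icc (hs : IsSeparated lx ux ly uy A B)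
    (hφ : φ ∈ starClass (lx, ly) (ux, uy)) (hx : x ∈ Icc lx ux) {r : (ℤ × ℤ) × Prop}
    (h : IsAnswer φ A B x r) : r.1 ∈ Icc lx ux := by
  obtain ⟨h1, h2, h3⟩ := hφ
  have k1 := h.1.mem_Icc hs (fun a b hab => (h1 hab).1.1.1) hx h2.1.1 h3.1.1 ⟨hx.1.1, hx.2.1⟩
  have k2 := h.2.1.mem_Icc hs (fun a b hab => (h1 hab).1.1.2) hx h2.1.2 h3.1.2 ⟨hx.1.2, hx.2.2⟩
  exact ⟨⟨k1.1, k2.1⟩, ⟨k1.2, k2.2⟩⟩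

/-- The answer of the simulated oracle at one point is found by five searches in the fibre. -/
theorem querySolvable_answer
    (hY : ∀ l u : Y, ly ≤ l → l ≤ u → u ≤ uy → StarSolvable l u q)
    (h : IsSeparated lx ux ly uy A B) (hx : x ∈ Icc lx ux) :
    QuerySolvable (Icc (lx, ly) (ux, uy))
      (fun (o : Set ((ℤ × ℤ) × Y) × Set ((ℤ × ℤ) × Y) × ((ℤ × ℤ) × Prop)) φ =>
        IsSeparated lx ux ly uy o.1 o.2.1 ∧ IsFibrewise φ o.1 o.2.1 ∧ A ⊆ o.1 ∧ B ⊆ o.2.1 ∧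
        IsAnswer φ o.1 o.2.1 x o.2.2)
      {φ | Monotone φ ∧ IsFibrewise φ A B} (5 * (q + 1)) := by
  let κ : ℕ → (ℤ × ℤ) × Prop → Prop
    | 0 => fun r => x.1 + 1 ≤ r.1.1
    | 1 => fun r => x.1 ≤ r.1.1
    | 2 => fun r => x.2 + 1 ≤ r.1.2
    | 3 => fun r => x.2 ≤ r.1.2
    | _ => fun r => r.2
  have hκ : ∀ i, Monotone (κ i)
    | 0 => fun _ _ h h' => le_trans h' h.1.1
    | 1 => fun _ _ h h' => le_trans h' h.1.1
    | 2 => fun _ _ h h' => le_trans h' h.1.2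
    | 3 => fun _ _ h h' => le_trans h' h.1.2
    | _ + 4 => fun _ _ h h' => h.2 h'
  have : Nonempty (Set ((ℤ × ℤ) × Y) × Set ((ℤ × ℤ) × Y) × ((ℤ × ℤ) × Prop)) :=
    ⟨(A, B, (x, True))⟩
  refine (querySolvable_tests hY h hx hκ 5).bind (q' := 0) fun o => ?_
  obtain ⟨v, hv⟩ := exists_isRounded (A := o.1) (B := o.2.1) (x := x)
    (fun r : (ℤ × ℤ) × Prop => r.1.1) x.1 (t₁ := o.2.2 0) (t₂ := o.2.2 1)
  obtain ⟨w, hw⟩ := exists_isRounded (A := o.1) (B := o.2.1) (x := x)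
    (fun r : (ℤ × ℤ) × Prop => r.1.2) x.2 (t₁ := o.2.2 2) (t₂ := o.2.2 3)
  refine .output (o.1, o.2.1, ((v, w), o.2.2 4)) ?_
  rintro φ ⟨-, g1, g2, g3, g4, g5⟩
  exact ⟨g1, g2, g3, g4, hv φ (g5 0 (by omega)) (g5 1 (by omega)),
    hw φ (g5 2 (by omega)) (g5 3 (by omega)), g5 4 (by omega)⟩

/-- The three witnesses in `A` over `x` may differ, but all lie below `lowerEnd A x`; by
monotonicity their lower bounds and the membership in `S` hold there simultaneously. -/
theorem IsAnswer.isStarPoint_lowerEnd (hs : IsSeparated lx ux ly uy A B) (hφ : Monotone φ)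
    (hf : IsFibrewise φ A B) (hx : x ∈ Icc lx ux) {r : (ℤ × ℤ) × Prop} (h : IsAnswer φ A B x r)
    (hr : x ≤ r.1) (hr' : r.2) : IsStarPoint φ (x, lowerEnd A x) := by
  obtain ⟨y₁, hy₁, k₁⟩ := h.1.2.2.1 hr.1
  obtain ⟨y₂, hy₂, k₂⟩ := h.2.1.2.2.1 hr.2
  obtain ⟨y₃, hy₃, k₃⟩ := h.2.2.1 hr'
  have key : ∀ y, (x, y) ∈ A → φ (x, y) ≤ φ (x, lowerEnd A x) := fun y hy =>
    hφ (Prod.mk_le_mk.2 ⟨le_rfl, hs.le_lowerEnd le_rfl hy⟩)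
  exact Or.inl ⟨⟨⟨hr.1.trans (k₁.trans (key _ hy₁).1.1.1), hr.2.trans (k₂.trans (key _ hy₂).1.1.2)⟩,
    hs.lowerEnd_le_map hx.1 hφ hf⟩, (key _ hy₃).2 k₃⟩

theorem IsAnswer.isStarPoint_upperEnd (hs : IsSeparated lx ux ly uy A B) (hφ : Monotone φ)
    (hf : IsFibrewise φ A B) (hx : x ∈ Icc lx ux) {r : (ℤ × ℤ) × Prop} (h : IsAnswer φ A B x r)
    (hr : r.1 ≤ x) (hr' : ¬ r.2) : IsStarPoint φ (x, upperEnd B x) := by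
  obtain ⟨y₁, hy₁, k₁⟩ := h.1.2.2.2 hr.1
  obtain ⟨y₂, hy₂, k₂⟩ := h.2.1.2.2.2 hr.2
  obtain ⟨y₃, hy₃, k₃⟩ := h.2.2.2 hr'
  have key : ∀ y, (x, y) ∈ B → φ (x, upperEnd B x) ≤ φ (x, y) := fun y hy =>
    hφ (Prod.mk_le_mk.2 ⟨le_rfl, hs.upperEnd_le le_rfl hy⟩)
  exact Or.inr ⟨⟨⟨((key _ hy₁).1.1.1.trans k₁).trans hr.1, ((key _ hy₂).1.1.2.trans k₂).trans hr.2⟩,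
    hs.map_le_upperEnd hx.2 hφ hf⟩, fun h => k₃ ((key _ hy₃).2 h)⟩

/-- The oracles for which `A`, `B` are valid search points that justify the answers in `D`. -/
def answerClass (lx ux : ℤ × ℤ) (ly uy : Y) (A B : Set ((ℤ × ℤ) × Y))
    (D : Set ((ℤ × ℤ) × ((ℤ × ℤ) × Prop))) : Set ((ℤ × ℤ) × Y → ((ℤ × ℤ) × Y) × Prop) :=
  {φ | φ ∈ starClass (lx, ly) (ux, uy) ∧ IsFibrewise φ A B ∧
    ∀ d ∈ D, d.1 ∈ Icc lx ux ∧ IsAnswer φ A B d.1 d.2}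

/-- This legitimizes the simulation: rounded answers need not come from a planar slice of `φ`, yet
the planar algorithm cannot tell them from those of an oracle in its class. -/
theorem exists_extension_of_mem_answerClass (hlu : lx ≤ ux) (hs : IsSeparated lx ux ly uy A B)
    {D : Set ((ℤ × ℤ) × ((ℤ × ℤ) × Prop))} (hφ : φ ∈ answerClass lx ux ly uy A B D) :
    ∃ Φ ∈ starClass lx ux, ∀ d ∈ D, Φ d.1 = d.2 :=
  exists_starClass_extension hlu (fun d hd => (hφ.2.2 d hd).2.mem_Icc hs hφ.1 (hφ.2.2 d hd).1)
    fun d hd d' hd' h => (hφ.2.2 d hd).2.le hs hφ.1.1 (hφ.2.2 d' hd').2 h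

/-- Simulation of a planar search: its queries are answered by searches in the fibres. -/
theorem querySolvable_simulate (hlu : lx ≤ ux)
    (hY : ∀ l u : Y, ly ≤ l → l ≤ u → u ≤ uy → StarSolvable l u q)
    {P : Set (ℤ × ℤ → (ℤ × ℤ) × Prop)} {q₀ : ℕ}
    (hX : QuerySolvable (Icc lx ux) (fun z φ => z ∈ Icc lx ux ∧ IsStarPoint φ z) P q₀) :
    ∀ (A B : Set ((ℤ × ℤ) × Y)) (D : Set ((ℤ × ℤ) × ((ℤ × ℤ) × Prop))),
      IsSeparated lx ux ly uy A B →
      (∀ Φ ∈ starClass lx ux, (∀ d ∈ D, Φ d.1 = d.2) → Φ ∈ P) →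
      QuerySolvable (Icc (lx, ly) (ux, uy))
        (fun z φ => z ∈ Icc (lx, ly) (ux, uy) ∧ IsStarPoint φ z) (answerClass lx ux ly uy A B D)
        ((q₀ + 1) * (5 * (q + 1))) := by
  have : Nonempty ((ℤ × ℤ) × Y) := ⟨(lx, ly)⟩
  have extend : ∀ {A B A' B' : Set ((ℤ × ℤ) × Y)} {D : Set ((ℤ × ℤ) × ((ℤ × ℤ) × Prop))}
      {x : ℤ × ℤ} {r : (ℤ × ℤ) × Prop} {φ : (ℤ × ℤ) × Y → ((ℤ × ℤ) × Y) × Prop},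
      φ ∈ answerClass lx ux ly uy A B D → x ∈ Icc lx ux → A ⊆ A' → B ⊆ B' →
      IsFibrewise φ A' B' → IsAnswer φ A' B' x r →
      φ ∈ answerClass lx ux ly uy A' B' (insert (x, r) D) := by
    intro A B A' B' D x r φ hφ hx hA hB hf ha
    refine ⟨hφ.1, hf, ?_⟩
    rintro d (rfl | hd)
    · exact ⟨hx, ha⟩
    · exact ⟨(hφ.2.2 d hd).1, (hφ.2.2 d hd).2.mono hA hB⟩
  induction hX with
  | @output P q₀ x h =>
    intro A B D hs hP
    by_cases hx : x ∈ Icc lx ux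
    swap
    · refine .of_isEmpty fun φ hφ => hx ?_
      obtain ⟨Φ, h1, h2⟩ := exists_extension_of_mem_answerClass hlu hs hφ
      exact (h Φ (hP Φ h1 h2)).1
    -- The output point is answered once more to obtain witnesses over it, which accounts for `q₀ +
    -- 1`.
    refine QuerySolvable.mono (q := 5 * (q + 1) + 0) ?_ subset_rfl (by nlinarith)
    refine ((querySolvable_answer hY hs hx).mono (fun φ hφ => ⟨hφ.1.1, hφ.2.1⟩) le_rfl).bind
      fun o => ?_
    classical
    refine .output (if x ≤ o.2.2.1 ∧ o.2.2.2 then (x, lowerEnd o.1 x) else (x, upperEnd o.2.1 x)) ?_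
    rintro φ ⟨hφ, g1, g2, g3, g4, g5⟩
    obtain ⟨Φ, k1, k2⟩ := exists_extension_of_mem_answerClass hlu g1 (extend hφ hx g3 g4 g2 g5)
    have k3 := (h Φ (hP Φ k1 fun d hd => k2 d (Or.inr hd))).2
    have k4 : Φ x = o.2.2 := k2 (x, o.2.2) (mem_insert _ _)
    rw [IsStarPoint, k4] at k3
    split_ifs with hc
    · exact ⟨⟨⟨hx.1, g1.le_lowerEnd_bot hx.1⟩,
        ⟨hx.2, (g1.lowerEnd_le_upperEnd hx).trans (g1.upperEnd_le_top hx.2)⟩⟩,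
        g5.isStarPoint_lowerEnd g1 hφ.1.1 g2 hx hc.1 hc.2⟩
    · have hc' := k3.resolve_left hc
      exact ⟨⟨⟨hx.1, (g1.le_lowerEnd_bot hx.1).trans (g1.lowerEnd_le_upperEnd hx)⟩,
        ⟨hx.2, g1.upperEnd_le_top hx.2⟩⟩,
        g5.isStarPoint_upperEnd g1 hφ.1.1 g2 hx hc'.1 hc'.2⟩
  | @query P q₀ x hx h ih =>
    intro A B D hs hP
    refine QuerySolvable.mono (q := 5 * (q + 1) + (q₀ + 1) * (5 * (q + 1))) ?_ subset_rfl
      (by apply le_of_eq; ring)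
    refine ((querySolvable_answer hY hs hx).mono (fun φ hφ => ⟨hφ.1.1, hφ.2.1⟩) le_rfl).bind
      fun o => ?_
    by_cases ho : IsSeparated lx ux ly uy o.1 o.2.1
    swap
    · exact .of_isEmpty fun φ hφ => ho hφ.2.1
    refine (ih o.2.2 o.1 o.2.1 (insert (x, o.2.2) D) ho fun Φ h1 h2 => ?_).mono ?_ le_rfl
    · exact ⟨hP Φ h1 fun d hd => h2 d (Or.inr hd), h2 (x, o.2.2) (mem_insert _ _)⟩
    · rintro φ ⟨hφ, g1, g2, g3, g4, g5⟩
      exact extend hφ hx g3 g4 g2 g5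

/-- The decomposition theorem: query complexities multiply, up to a constant. -/
theorem StarSolvable.prod {q₀ : ℕ} (hlu : lx ≤ ux) (hluy : ly ≤ uy)
    (hX : StarSolvable lx ux q₀)
    (hY : ∀ l u : Y, ly ≤ l → l ≤ u → u ≤ uy → StarSolvable l u q) :
    StarSolvable (lx, ly) (ux, uy) ((q₀ + 1) * (5 * (q + 1))) := by
  -- The corners of the box are the first search points, and no answer is recorded yet.
  refine (querySolvable_simulate hlu hY hX {(lx, ly)} {(ux, uy)} ∅ ?_ ?_).mono ?_ le_rfl
  · constructor <;> simp [hluy]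
  · exact fun Φ h _ => h
  · intro φ hφ
    refine ⟨hφ, ⟨?_, ?_⟩, by simp⟩
    · rintro z rfl
      exact hφ.2.1.2
    · rintro z rfl
      exact hφ.2.2.2

end Compose

/-! ### Even dimensions -/

/-- The number of queries for the relaxed Tarski problem in dimension `2 * m` on boxes of side
length `2 ^ L`. -/
def starCost (L : ℕ) : ℕ → ℕ
  | 0 => 0
  | m + 1 => (20 * L + 26 + 1) * (5 * (starCost L m + 1))

/-- For `L ≥ 1` one has `20 * L + 27 ≤ 47 * L`, so a step multiplies by at most `235 * L`; the
additional `1` raises this to `236`. -/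
theorem starCost_succ_le {L : ℕ} (hL : 1 ≤ L) (m : ℕ) : starCost L m + 1 ≤ (236 * L) ^ m := by
  induction m with
  | zero => simp [starCost]
  | succ m ih =>
    have h1 : starCost L (m + 1) ≤ (47 * L) * (5 * (236 * L) ^ m) :=
      Nat.mul_le_mul (by omega) (by omega)
    have h2 : 1 ≤ L * (236 * L) ^ m := Nat.mul_pos hL (Nat.pow_pos (by omega))
    calc starCost L (m + 1) + 1 ≤ (47 * L) * (5 * (236 * L) ^ m) + L * (236 * L) ^ m := by omega
      _ = (236 * L) ^ (m + 1) := by ring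

/-- The relaxed Tarski problem in dimension `2 * m` takes `O(L ^ m)` queries. -/
theorem starSolvable_pi (L m : ℕ) : ∀ l u : Fin (2 * m) → ℤ, l ≤ u → (∀ i, u i - l i < 2 ^ L) →
    StarSolvable l u (starCost L m) := by
  induction m with
  | zero =>
    intro l u hlu _
    have : IsEmpty (Fin (2 * 0)) := inferInstanceAs (IsEmpty (Fin 0))
    refine .output l fun φ _ => ⟨⟨le_rfl, hlu⟩, ?_⟩
    by_cases h : (φ l).2
    · exact Or.inl ⟨fun i => isEmptyElim i, h⟩
    · exact Or.inr ⟨fun i => isEmptyElim i, h⟩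
  | succ m ih =>
    intro l u hlu hw
    let e : (Fin (2 * m + 2) → ℤ) → (ℤ × ℤ) × (Fin (2 * m) → ℤ) :=
      fun z => ((z 0, z 1), fun i => z i.succ.succ)
    let p : (ℤ × ℤ) × (Fin (2 * m) → ℤ) → Fin (2 * m + 2) → ℤ :=
      fun w => Fin.cons w.1.1 (Fin.cons w.1.2 w.2 : Fin (2 * m + 1) → ℤ)
    have he : Monotone e := fun z z' h => ⟨⟨h 0, h 1⟩, fun i => h _⟩
    have hp : Monotone p := by
      intro w w' h i
      refine Fin.cases h.1.1 (fun i => ?_) i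
      exact Fin.cases h.1.2 (fun i => h.2 i) i
    have hpe : ∀ z, p (e z) = z := by
      intro z
      funext i
      refine Fin.cases rfl (fun i => ?_) i
      exact Fin.cases rfl (fun i => rfl) i
    refine StarSolvable.retract (l := l) (u := u) he hp hpe ?_
    refine StarSolvable.prod (he hlu).1 (he hlu).2
      (starSolvable_plane (he hlu).1 (hw _) (hw _)) fun l' u' h1 h2 h3 => ih l' u' h2 fun i => ?_
    have := h1 i
    have := h3 i
    have := hw i.succ.succ
    dsimp only [e] at *
    omega

/-! ### From relaxed searches to fixed points -/

/-- Binary search for a fixed point in all coordinates, by means of relaxed searches in the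
hyperplanes. -/
theorem querySolvable_fixedPoint {K L q : ℕ}
    (hS : ∀ l u : Fin K → ℤ, l ≤ u → (∀ i, u i - l i < 2 ^ L) → StarSolvable l u q) (N : ℕ) :
    ∀ (p : Fin (K + 1) → ℕ) (l u : Fin (K + 1) → ℤ), ∑ i, p i ≤ N → (∀ i, p i ≤ L) → l ≤ u →
      (∀ i, u i - l i < 2 ^ p i) →
      QuerySolvable univ (fun z (f : (Fin (K + 1) → ℤ) → Fin (K + 1) → ℤ) => f z = z)
        {f | Monotone f ∧ l ≤ f l ∧ f u ≤ u} (N * (q + 1)) := by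
  induction N with
  | zero =>
    intro p l u hp _ hlu hw
    have : l = u := by
      refine le_antisymm hlu fun i => ?_
      have h1 : p i = 0 := by
        have := Finset.single_le_sum (fun j _ => Nat.zero_le (p j)) (Finset.mem_univ i)
        omega
      have h2 := hw i
      rw [h1, pow_zero] at h2
      exact sub_nonpos.1 (Int.lt_add_one_iff.1 h2)
    subst this
    exact .output l fun f hf => le_antisymm hf.2.2 hf.2.1
  | succ N ih =>
    intro p l u hp hpL hlu hw
    by_cases hlu' : l = u
    · subst hlu'
      exact .output l fun f hf => le_antisymm hf.2.2 hf.2.1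
    obtain ⟨i, hi⟩ : ∃ i, l i < u i := by
      by_contra! h
      exact hlu' (le_antisymm hlu h)
    obtain ⟨s, hs⟩ : ∃ s, p i = s + 1 := by
      have := hw i
      rcases h : p i with - | s
      · rw [h] at this
        omega
      · exact ⟨s, rfl⟩
    have hwi := hw i
    rw [hs, pow_succ] at hwi
    -- The midpoint is rounded up: the halves are `[l i, c - 1]` and `[c, u i]`, both nonempty and
    -- of length below `2 ^ s`.
    obtain ⟨c, hc₁, hc₂, hc₃, hc₄⟩ : ∃ c, l i < c ∧ c ≤ u i ∧ c - 1 - l i < 2 ^ s ∧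
      u i - c < 2 ^ s := ⟨l i + (u i - l i + 1) / 2, by omega, by omega, by omega, by omega⟩
    let p' := Function.update p i s
    have hp'i : p' i = s := Function.update_self ..
    have hp'j : ∀ j, j ≠ i → p' j = p j := fun j hj => Function.update_of_ne hj ..
    have hp'le : ∀ j, p' j ≤ p j := by
      intro j
      by_cases hj : j = i
      · subst hj; omega
      · exact (hp'j j hj).le
    have hp' : ∑ j, p' j ≤ N := by
      have : ∑ j, p' j < ∑ j, p j :=
        Finset.sum_lt_sum (fun j _ => hp'le j) ⟨i, Finset.mem_univ i, by omega⟩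
      omega
    have insert_mono : ∀ {a b : ℤ} {y y' : Fin K → ℤ}, a ≤ b → y ≤ y' →
        (i.insertNth a y : Fin (K + 1) → ℤ) ≤ i.insertNth b y' := by
      intro a b y y' hab hy
      rw [Fin.insertNth_le_iff]
      simpa using ⟨hab, fun j => by simpa using hy j⟩
    have hl : (i.insertNth (l i) (i.removeNth l) : Fin (K + 1) → ℤ) = l :=
      Fin.insertNth_self_removeNth ..
    have hu : (i.insertNth (u i) (i.removeNth u) : Fin (K + 1) → ℤ) = u :=
      Fin.insertNth_self_removeNth ..
    have hsearch := QuerySolvable.comap (X' := univ)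
      (P' := {f : (Fin (K + 1) → ℤ) → Fin (K + 1) → ℤ | Monotone f ∧ l ≤ f l ∧ f u ≤ u})
      (hS (i.removeNth l) (i.removeNth u) (fun j => hlu _) fun j =>
        (hw _).trans_le (pow_le_pow_right₀ (by norm_num) (hpL _)))
      (fun f y => (i.removeNth (f (i.insertNth c y)), c ≤ f (i.insertNth c y) i))
      (fun y => i.insertNth c y) (fun _ r => (i.removeNth r, c ≤ r i)) (fun _ _ => rfl)
      (fun _ _ => mem_univ _)
      (by
        rintro f ⟨h1, h2, h3⟩
        refine ⟨fun y y' hy => ?_, fun j => ?_, fun j => ?_⟩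
        · have := h1 (insert_mono (le_refl c) hy)
          exact ⟨fun j => this _, fun h => le_trans h (this _)⟩
        · have := h2.trans (h1 (hl.symm.le.trans (insert_mono hc₁.le le_rfl)))
          exact this _
        · have := (h1 ((insert_mono hc₂ le_rfl).trans hu.le)).trans h3
          exact this _)
    refine QuerySolvable.mono (q := q + (N * (q + 1) + 1)) ?_ subset_rfl (by linarith)
    refine hsearch.bind fun y => ?_
    by_cases hy : y ∈ Icc (i.removeNth l) (i.removeNth u)
    swap
    · exact .of_isEmpty fun f hf => hy hf.2.1
    refine QuerySolvable.query_of_mem (i.insertNth c y) (mem_univ _) fun f₀ h₀ => ?_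
    have le_iff : ∀ z : Fin (K + 1) → ℤ, (i.insertNth c y : Fin (K + 1) → ℤ) ≤ z ↔
        c ≤ z i ∧ y ≤ i.removeNth z := fun z => Fin.insertNth_le_iff
    rcases h₀.2.2 with ⟨k1, k2⟩ | ⟨k1, k2⟩
    · refine (ih p' (i.insertNth c y) u hp' (fun j => (hp'le j).trans (hpL j))
        ((insert_mono hc₂ hy.2).trans hu.le) ?_).mono ?_ le_rfl
      · intro j
        rcases Fin.eq_self_or_eq_succAbove i j with rfl | ⟨j, rfl⟩
        · simpa [hp'i] using hc₄
        · rw [hp'j _ (Fin.succAbove_ne i j), Fin.insertNth_apply_succAbove]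
          have := hy.1 j
          have := hw (i.succAbove j)
          simp only [Fin.removeNth] at *
          omega
      · rintro f ⟨⟨⟨h1, h2, h3⟩, -⟩, h4⟩
        refine ⟨h1, ?_, h3⟩
        rw [h4]
        exact (le_iff _).2 ⟨k2, k1⟩
    · refine (ih p' l (i.insertNth (c - 1) y) hp' (fun j => (hp'le j).trans (hpL j))
        (hl.symm.le.trans (insert_mono (by omega) hy.1)) ?_).mono ?_ le_rfl
      · intro j
        rcases Fin.eq_self_or_eq_succAbove i j with rfl | ⟨j, rfl⟩
        · simpa [hp'i] using hc₃
        · rw [hp'j _ (Fin.succAbove_ne i j), Fin.insertNth_apply_succAbove]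
          have := hy.2 j
          have := hw (i.succAbove j)
          simp only [Fin.removeNth] at *
          omega
      · rintro f ⟨⟨⟨h1, h2, h3⟩, -⟩, h4⟩
        refine ⟨h1, h2, ?_⟩
        -- Lowering the coordinate to `c - 1` can only lower the values of `f`, and `f₀ i < c` at
        -- the queried point means `≤ c - 1`.
        have h5 : f (i.insertNth (c - 1) y) ≤ f₀ (i.insertNth c y) := by
          rw [← h4]
          exact h1 (insert_mono (by omega) le_rfl)
        rw [Fin.le_insertNth_iff]
        exact ⟨Int.le_sub_one_of_lt ((h5 i).trans_lt (not_le.1 k2)), fun j => (h5 _).trans (k1 j)⟩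

/-- Fixed points of monotone maps of `[n]^k` can be found with `O(log^(k / 2 + 1) n)` queries. -/
theorem querySolvable_grid (n k : ℕ) (hn : 1 ≤ n) :
    QuerySolvable univ (fun z (f : Grid n k → Grid n k) => f z = z) {f | Monotone f}
      ((2 * (k / 2) + 1) * Nat.clog 2 n * (starCost (Nat.clog 2 n) (k / 2) + 1)) := by
  have hk : k ≤ 2 * (k / 2) + 1 := by omega
  generalize k / 2 = m at *
  -- Zero padding reaches the odd dimension `2 * m + 1`; `p` clamps to the grid, so `e ∘ f ∘ p` maps
  -- everything into the cube and its corner conditions are automatic.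
  let e : Grid n k → Fin (2 * m + 1) → ℤ := fun g j => if h : (j : ℕ) < k then (g ⟨j, h⟩ : ℤ) else 0
  let p : (Fin (2 * m + 1) → ℤ) → Grid n k := fun z i =>
    ⟨(max 0 (min ((n : ℤ) - 1) (z (Fin.castLE hk i)))).toNat, by omega⟩
  have he : Monotone e := by
    intro g g' h j
    by_cases hj : (j : ℕ) < k
    · have : (g ⟨j, hj⟩ : ℕ) ≤ g' ⟨j, hj⟩ := h _
      simpa [e, hj] using this
    · simp [e, hj]
  have hp : Monotone p := by
    intro z z' h i
    exact Int.toNat_le_toNat (max_le_max le_rfl (min_le_min le_rfl (h (Fin.castLE hk i))))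
  have hpe : ∀ g, p (e g) = g := by
    intro g
    funext i
    refine Fin.ext ?_
    have := (g i).2
    simp only [p, e, Fin.val_castLE, Fin.is_lt, dite_true, Fin.eta]
    omega
  have he₀ : ∀ g, 0 ≤ e g := by
    intro g j
    by_cases hj : (j : ℕ) < k <;> simp [e, hj]
  have he₁ : ∀ g, e g ≤ fun _ => (n : ℤ) - 1 := by
    intro g j
    by_cases hj : (j : ℕ) < k
    · have := (g ⟨j, hj⟩).2
      simp only [e, hj, dite_true]
      omega
    · simp only [e, hj, dite_false]
      omega
  have hw : (n : ℤ) - 1 - 0 < 2 ^ Nat.clog 2 n := by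
    have := Nat.le_pow_clog (b := 2) (by norm_num) n
    have : (n : ℤ) ≤ 2 ^ Nat.clog 2 n := by exact_mod_cast this
    omega
  have key := querySolvable_fixedPoint (starSolvable_pi (Nat.clog 2 n) m)
    ((2 * m + 1) * Nat.clog 2 n) (fun _ => Nat.clog 2 n) 0 (fun _ => (n : ℤ) - 1) (by simp)
    (fun _ => le_rfl) (fun _ => by simpa using hn) (fun _ => hw)
  refine (key.comap (X' := univ) (P' := {f : Grid n k → Grid n k | Monotone f})
    (fun f z => e (f (p z))) p (fun _ r => e r) (fun _ _ => rfl) (fun _ _ => mem_univ _)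
    fun f hf => ⟨fun z z' h => he (hf (hp h)), he₀ _, he₁ _⟩).map p ?_
  intro z f _ h
  have := congrArg p h
  rwa [hpe] at this

/-- For `n ≥ 2`, adding `(clog - 1) * log 2 ≤ log n` and `log 2 ≤ log n` gives the factor `2 / log 2
< 4`; at `n = 1` both sides vanish. -/
theorem clog_two_le_four_mul_log {n : ℕ} (hn : 1 ≤ n) :
    (Nat.clog 2 n : ℝ) ≤ 4 * Real.log n := by
  rcases hn.eq_or_lt with rfl | hn
  · simp
  have h1 : 2 ^ (Nat.clog 2 n - 1) < n := Nat.pow_pred_clog_lt_self (by norm_num) hn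
  have h2 : 1 ≤ Nat.clog 2 n := Nat.clog_pos (by norm_num) hn
  have h3 : ((Nat.clog 2 n - 1 : ℕ) : ℝ) * Real.log 2 ≤ Real.log n := by
    rw [← Real.log_pow]
    exact Real.log_le_log (by positivity) (by exact_mod_cast h1.le)
  have h4 : Real.log 2 ≤ Real.log n := Real.log_le_log (by norm_num) (by exact_mod_cast hn)
  have h5 := Real.log_two_gt_d9
  rw [Nat.cast_sub h2] at h3
  push_cast at h3
  have h6 : (1 : ℝ) ≤ Nat.clog 2 n := by exact_mod_cast h2
  nlinarith

theorem ceil_succ_div_two (k : ℕ) : ⌈((k : ℝ) + 1) / 2⌉₊ = k / 2 + 1 := by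
  rw [Nat.ceil_eq_iff (by omega)]
  have h1 : k < 2 * (k / 2) + 2 := by omega
  have h2 : 2 * (k / 2) ≤ k := by omega
  have h1' : (k : ℝ) + 1 ≤ 2 * (k / 2 : ℕ) + 2 := by exact_mod_cast h1
  have h2' : 2 * ((k / 2 : ℕ) : ℝ) ≤ k := by exact_mod_cast h2
  constructor
  · simp only [Nat.add_sub_cancel]
    linarith
  · push_cast at *
    linarith

theorem theorem1 (k : ℕ) :
    ∃ (C : ℝ) (A : (n : ℕ) → 1 ≤ n → QueryAlgorithm n k),
      ∀ (n : ℕ) (hn : 1 ≤ n),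
        (A n hn).SolvesTarski (C * Real.log (n : ℝ) ^ ⌈((k : ℝ) + 1) / 2⌉₊) := by
  choose A hA using fun (n : ℕ) (hn : 1 ≤ n) => (querySolvable_grid n k hn).exists_queryAlgorithm
  refine ⟨(2 * (k / 2 : ℕ) + 1) * 236 ^ (k / 2) * 4 ^ (k / 2 + 1), A, fun n hn f hf => ?_⟩
  obtain ⟨h1, h2⟩ := hA n hn f hf
  refine ⟨h1, ?_⟩
  rw [ceil_succ_div_two]
  have hL := clog_two_le_four_mul_log hn
  generalize k / 2 = m at *
  generalize Nat.clog 2 n = L at *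
  have h3 : (2 * m + 1) * L * (starCost L m + 1) ≤ (2 * m + 1) * 236 ^ m * L ^ (m + 1) := by
    rcases Nat.eq_zero_or_pos L with rfl | hL
    · simp
    · calc (2 * m + 1) * L * (starCost L m + 1) ≤ (2 * m + 1) * L * (236 * L) ^ m :=
            Nat.mul_le_mul_left _ (starCost_succ_le hL m)
        _ = (2 * m + 1) * 236 ^ m * L ^ (m + 1) := by ring
  calc ((A n hn).numQueries f : ℝ) ≤ ((2 * m + 1) * 236 ^ m * L ^ (m + 1) : ℕ) := by
        exact_mod_cast h2.trans h3
    _ = (2 * m + 1) * 236 ^ m * (L : ℝ) ^ (m + 1) := by push_cast; ring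
    _ ≤ (2 * m + 1) * 236 ^ m * (4 * Real.log n) ^ (m + 1) := by gcongr
    _ = (2 * m + 1) * 236 ^ m * 4 ^ (m + 1) * Real.log n ^ (m + 1) := by ring
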